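/- **Setting.** Let $m,n\ge 0$, $\|\cdot\|_2$ the Euclidean norm of vectors and the spectral norm of matrices, $A^\dagger$ the Moore–Penrose inverse of $A$, and $\|(A,\mathbf b)\|=\sqrt{\|A\|_2^2+\|\mathbf b\|_2^2}$ on $\mathbb C^{m\times n}\times\mathbb C^m$; let $\|A^\dagger\|_2^{-1}=\infty$ if $A=0$. Let $\mathrm{sol}(A,\mathbf b)=\{\mathbf u\in\mathbb C^n : A\mathbf u=\mathbf b\}$. For affine subspaces of the same dimension, $\mathrm{dist}(\mathbf u_1+V_1,\mathbf u_2+V_2)=\max\{\|\hat{\mathbf u}_1-\hat{\mathbf u}_2\|_2,\ \|P_{V_1}-P_{V_2}\|_2\}$, where $\hat{\mathbf u}_j$ is the unique element of $V_j^\perp\cap(\mathbf u_j+V_j)$ and $P_V$ is the orthogonal projection onto $V$; the empty set has dimension $-1$ and $\mathrm{dist}(\emptyset,\emptyset)=0$. Let $\theta>0$. If $\theta$ is not a singular value of $G\in\mathbb C^{m\times n}$, the $\theta$-projection of $G$ is $G_\theta=\sum_{\sigma_j(G)>\theta}\sigma_j(G)\,\mathbf u_j\mathbf v_j^{\mathsf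 H}$ for a singular value decomposition of $G$ with singular vectors $\mathbf u_j,\mathbf v_j$, and, for $\mathbf d\in\mathbb C^m$, $\mathbf d_\theta=G_\theta G_\theta^\dagger\mathbf d$. The general numerical solution within $\theta$ is $\mathrm{sol}_\theta(G,\mathbf d)=\mathrm{sol}(G_\theta,\mathbf d_\theta)$ if $\|(G,\mathbf d)-(G_\theta,\mathbf d_\theta)\|<\theta$ and $\mathrm{sol}_\theta(G,\mathbf d)=\emptyset$ if $\|(G,\mathbf d)-(G_\theta,\mathbf d_\theta)\|>\theta$; it is undefined if $\theta$ is a singular value of $G$ or $\|(G,\mathbf d)-(G_\theta,\mathbf d_\theta)\|=\theta$. When $\mathrm{sol}_\theta(G,\mathbf d)=\mathrm{sol}(G_\theta,\mathbf d_\theta)$, its backward error is $\|(G,\mathbf d)-(G_\theta,\mathbf d_\theta)\|$. **Theorem.** Let $A\in\mathbb C^{m\times n}$ and $\mathbf b\in\mathbb C^m$. (i) $\mathrm{sol}_\theta(A,\mathbf b)$ is well-defined and equals $\mathrm{sol}(A,\mathbf b)$ for all $\theta>0$ with $\theta<\|A^\dagger\|_2^{-1}$ if $\mathbf b\in\mathrm{Range}(A)$,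 and with $\theta<\min\{\|A^\dagger\|_2^{-1},\|\mathbf b-AA^\dagger\mathbf b\|_2\}$ otherwise. (ii) Assume that $\mathrm{sol}_\theta(A,\mathbf b)$ is well-defined for a certain $\theta>0$. Then there are $\xi,\delta>0$ depending on $A,\mathbf b,\theta$ such that for all $(\Delta A,\Delta\mathbf b)$ with $\|(\Delta A,\Delta\mathbf b)\|<\delta$ the solution $\mathrm{sol}_\theta(A+\Delta A,\mathbf b+\Delta\mathbf b)$ exists, is unique, has the same dimension as $\mathrm{sol}_\theta(A,\mathbf b)$, and $$\mathrm{dist}\big(\mathrm{sol}_\theta(A+\Delta A,\mathbf b+\Delta\mathbf b),\mathrm{sol}_\theta(A,\mathbf b)\big)\le\xi\,\|(\Delta A,\Delta\mathbf b)\|.$$ (iii)(a) Assume $\mathbf b\in\mathrm{Range}(A)$, and let $\mathbf x_*=A^\dagger\mathbf b$ and $\omega=\sqrt{4\|A^\dagger\|_2^2\|\mathbf b\|_2^2+2}$. Let $\|(\Delta A,\Delta\mathbf b)\|<\big((\omega+1)\|A^\dagger\|_2\big)^{-1}$ (no condition if $A=0$) and $(\tilde A,\tilde{\mathbf b})=(A+\Delta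 A,\mathbf b+\Delta\mathbf b)$. For every $\theta$ with $\omega\|(\Delta A,\Delta\mathbf b)\|<\theta<\|A^\dagger\|_2^{-1}-\|(\Delta A,\Delta\mathbf b)\|$ the solution $\mathrm{sol}_\theta(\tilde A,\tilde{\mathbf b})$ exists, is unique, equals $\mathrm{sol}(\tilde A_\theta,\tilde{\mathbf b}_\theta)$, has backward error at most $\omega\|(\Delta A,\Delta\mathbf b)\|$ and the same dimension as $\mathrm{sol}(A,\mathbf b)$, and $$\mathrm{dist}\big(\mathrm{sol}_\theta(\tilde A,\tilde{\mathbf b}),\mathrm{sol}(A,\mathbf b)\big)\le\|A\|_2\|A^\dagger\|_2\,\frac{\sqrt{4\|\mathbf x_*\|_2^2+1}}{\|A\|_2-\|A\|_2\|A^\dagger\|_2\|\Delta A\|_2}\,\|(\Delta A,\Delta\mathbf b)\|,$$ where the right-hand side is read as $0$ if $A=0$. (iii)(b) Assume $\mathrm{sol}(A,\mathbf b)=\emptyset$. For every $\theta>0$ with $\theta<\min\{\tfrac12\|A^\dagger\|_2^{-1},\|\mathbf b-AA^\dagger\mathbf b\|_2\}$ there is a $\rho\in(0,\theta)$ such that $\mathrm{sol}_\theta(\tilde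 A,\tilde{\mathbf b})$ is well-defined and equals $\mathrm{sol}(A,\mathbf b)=\emptyset$ for all $(\tilde A,\tilde{\mathbf b})$ with $\|(\tilde A,\tilde{\mathbf b})-(A,\mathbf b)\|<\rho$. -/

import Mathlib

open scoped Matrix Matrix.Norms.L2Operator

namespace SingularSystem

noncomputable section

/-- The action of an `m × n` complex matrix on `ℂⁿ` (with its Euclidean norm). -/
def act {m n : ℕ} (A : Matrix (Fin m) (Fin n) ℂ) (x : EuclideanSpace ℂ (Fin n)) :
    EuclideanSpace ℂ (Fin m) :=
  Matrix.toEuclideanLin A x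

/-- `Range(A)`, a subspace of `ℂᵐ`. -/
def matRange {m n : ℕ} (A : Matrix (Fin m) (Fin n) ℂ) : Submodule ℂ (EuclideanSpace ℂ (Fin m)) :=
  LinearMap.range (Matrix.toEuclideanLin A)

/-- The norm `‖(A, b)‖ = √(‖A‖₂² + ‖b‖₂²)` on `ℂ^{m×n} × ℂᵐ`; the norm of a matrix is the spectral
norm. -/
def pairNorm {m n : ℕ} (A : Matrix (Fin m) (Fin n) ℂ) (b : EuclideanSpace ℂ (Fin m)) : ℝ :=
  Real.sqrt (‖A‖ ^ 2 + ‖b‖ ^ 2)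

/-! ### The Moore-Penrose inverse -/

/-- The four Moore-Penrose conditions for `X` to be the Moore-Penrose inverse of `A`. -/
structure IsMoorePenrose {m n : ℕ} (A : Matrix (Fin m) (Fin n) ℂ)
    (X : Matrix (Fin n) (Fin m) ℂ) : Prop where
  mul_mul_left : A * X * A = A
  mul_mul_right : X * A * X = X
  herm_left : (A * X)ᴴ = A * X
  herm_right : (X * A)ᴴ = X * A

theorem IsMoorePenrose.unique {m n : ℕ} {A : Matrix (Fin m) (Fin n) ℂ}
    {X Y : Matrix (Fin n) (Fin m) ℂ} (hX : IsMoorePenrose A X) (hY : IsMoorePenrose A Y) :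
    X = Y := by
  have h1 : A * X = A * Y := by
    have : (A * X)ᴴ = (A * Y * (A * X))ᴴ := by
      rw [← Matrix.mul_assoc (A * Y) A X, hY.mul_mul_left]
    rw [Matrix.conjTranspose_mul (A * Y), hX.herm_left, hY.herm_left,
      ← Matrix.mul_assoc (A * X) A Y, hX.mul_mul_left] at this
    exact this
  have h2 : X * A = Y * A := by
    have : (X * A)ᴴ = (X * A * (Y * A))ᴴ := by
      rw [Matrix.mul_assoc X A (Y * A), ← Matrix.mul_assoc A Y A, hY.mul_mul_left]
    rw [Matrix.conjTranspose_mul (X * A), hX.herm_right, hY.herm_right,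
      Matrix.mul_assoc Y A (X * A), ← Matrix.mul_assoc A X A, hX.mul_mul_left] at this
    exact this
  calc X = X * A * X := hX.mul_mul_right.symm
    _ = Y * A * X := by rw [h2]
    _ = Y * (A * X) := Matrix.mul_assoc _ _ _
    _ = Y * (A * Y) := by rw [h1]
    _ = Y * A * Y := (Matrix.mul_assoc _ _ _).symm
    _ = Y := hY.mul_mul_right

open scoped ComplexOrder in
theorem exists_isMoorePenrose {m n : ℕ} (A : Matrix (Fin m) (Fin n) ℂ) :
    ∃ X, IsMoorePenrose A X := by
  obtain ⟨K, hK, hHK, hKHK⟩ : ∃ K : Matrix (Fin n) (Fin n) ℂ, Kᴴ = K ∧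
      (Aᴴ * A) * K * (Aᴴ * A) = Aᴴ * A ∧ K * (Aᴴ * A) = (Aᴴ * A) * K := by
    have hH : (Aᴴ * A).IsHermitian := Matrix.isHermitian_conjTranspose_mul_self A
    set H := Aᴴ * A with hHdef
    have hs := hH.spectral_theorem
    rw [Unitary.conjStarAlgAut_apply] at hs
    set W : Matrix (Fin n) (Fin n) ℂ := (hH.eigenvectorUnitary : Matrix (Fin n) (Fin n) ℂ) with hW
    have hWW : star W * W = 1 := Unitary.coe_star_mul_self hH.eigenvectorUnitary
    set D : Matrix (Fin n) (Fin n) ℂ := Matrix.diagonal (RCLike.ofReal ∘ hH.eigenvalues) with hD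
    set E : Matrix (Fin n) (Fin n) ℂ :=
      Matrix.diagonal (fun i => ((hH.eigenvalues i : ℂ))⁻¹) with hE
    have hDED : D * E * D = D := by
      rw [hD, hE, Matrix.diagonal_mul_diagonal, Matrix.diagonal_mul_diagonal]
      congr 1
      funext i
      exact mul_inv_mul_cancel _
    have hDE : E * D = D * E := by
      rw [hD, hE, Matrix.diagonal_mul_diagonal, Matrix.diagonal_mul_diagonal]
      congr 1
      funext i
      exact mul_comm _ _
    have key : ∀ P Q : Matrix (Fin n) (Fin n) ℂ,
        (W * P * star W) * (W * Q * star W) = W * (P * Q) * star W := by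
      intro P Q
      calc (W * P * star W) * (W * Q * star W) = W * P * (star W * W) * Q * star W := by
            simp only [Matrix.mul_assoc]
        _ = W * (P * Q) * star W := by rw [hWW, Matrix.mul_one, Matrix.mul_assoc W P Q]
    refine ⟨W * E * star W, ?_, ?_, ?_⟩
    · rw [Matrix.conjTranspose_mul, Matrix.conjTranspose_mul, hE, Matrix.diagonal_conjTranspose,
        Matrix.star_eq_conjTranspose, Matrix.conjTranspose_conjTranspose, Matrix.mul_assoc]
      congr 3
      funext i
      simp
    · rw [hs, key, key, hDED]
    · rw [hs, key, key, hDE]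
  have hz : A * (1 - K * (Aᴴ * A)) = 0 := by
    rw [← Matrix.conjTranspose_mul_self_eq_zero]
    have : Aᴴ * (A * (1 - K * (Aᴴ * A))) = 0 := by
      rw [← Matrix.mul_assoc, Matrix.mul_sub, Matrix.mul_one, ← Matrix.mul_assoc, hHK, sub_self]
    rw [Matrix.conjTranspose_mul, Matrix.mul_assoc, this, Matrix.mul_zero]
  have hA : A * (K * (Aᴴ * A)) = A := by
    rw [Matrix.mul_sub, Matrix.mul_one, sub_eq_zero] at hz
    exact hz.symm
  have hA' : Aᴴ * A * K * Aᴴ = Aᴴ := by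
    have h := congrArg Matrix.conjTranspose hA
    simp only [Matrix.conjTranspose_mul, Matrix.conjTranspose_conjTranspose, hK] at h
    exact h
  refine ⟨K * Aᴴ, ?_, ?_, ?_, ?_⟩
  · rw [Matrix.mul_assoc, Matrix.mul_assoc]
    exact hA
  · calc K * Aᴴ * A * (K * Aᴴ) = K * (Aᴴ * A * K * Aᴴ) := by simp only [Matrix.mul_assoc]
      _ = K * Aᴴ := by rw [hA']
  · simp only [Matrix.conjTranspose_mul, Matrix.conjTranspose_conjTranspose, hK, Matrix.mul_assoc]
  · rw [Matrix.mul_assoc, Matrix.conjTranspose_mul, hK, Matrix.conjTranspose_mul,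
      Matrix.conjTranspose_conjTranspose, hKHK]

/-- The Moore-Penrose inverse `A†`: the unique matrix satisfying the Moore-Penrose conditions. -/
def pinv {m n : ℕ} (A : Matrix (Fin m) (Fin n) ℂ) : Matrix (Fin n) (Fin m) ℂ :=
  (exists_isMoorePenrose A).choose

theorem isMoorePenrose_pinv {m n : ℕ} (A : Matrix (Fin m) (Fin n) ℂ) :
    IsMoorePenrose A (pinv A) :=
  (exists_isMoorePenrose A).choose_spec

/-- `A A† b`, the orthogonal projection of `b` onto `Range(A)`. -/
def rangeProj {m n : ℕ} (A : Matrix (Fin m) (Fin n) ℂ) (b : EuclideanSpace ℂ (Fin m)) :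
    EuclideanSpace ℂ (Fin m) :=
  act A (act (pinv A) b)

/-! ### Singular value decomposition and `θ`-projection -/

/-- The `m × n` matrix with entries `s 0, s 1, …` on its main diagonal and `0` elsewhere. -/
def rectDiag (m n : ℕ) (s : ℕ → ℝ) : Matrix (Fin m) (Fin n) ℂ :=
  Matrix.of fun i j => if (i : ℕ) = (j : ℕ) then ((s i : ℝ) : ℂ) else 0

/-- `A = U Σ Vᴴ` is a singular value decomposition: `U`, `V` are unitary and
`Σ = diag(s 0, s 1, …)` with singular values `s 0 ≥ s 1 ≥ … ≥ 0`, where `s k` is the `(k+1)`-st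
largest singular value for `k < min m n`, and `s k = 0` for the irrelevant indices `k ≥ min m n`. -/
structure IsSVD {m n : ℕ} (A : Matrix (Fin m) (Fin n) ℂ)
    (U : Matrix (Fin m) (Fin m) ℂ) (s : ℕ → ℝ) (V : Matrix (Fin n) (Fin n) ℂ) : Prop where
  unitary_left : U ∈ Matrix.unitaryGroup (Fin m) ℂ
  unitary_right : V ∈ Matrix.unitaryGroup (Fin n) ℂ
  nonneg : ∀ k, 0 ≤ s k
  antitone : Antitone s
  eq_zero : ∀ k, min m n ≤ k → s k = 0
  eq_mul : A = U * rectDiag m n s * Vᴴ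

/-- `B` is the `θ`-projection `A_θ = ∑_{σ_j(A) > θ} σ_j(A) u_j v_jᴴ` of `A`. It is defined only if
`θ > 0` is not a singular value of `A`. -/
def IsThetaProj {m n : ℕ} (θ : ℝ) (A B : Matrix (Fin m) (Fin n) ℂ) : Prop :=
  0 < θ ∧ ∃ U s V, IsSVD A U s V ∧ (∀ k, s k ≠ θ) ∧
    B = U * rectDiag m n (fun k => if θ < s k then s k else 0) * Vᴴ

/-! ### Solution sets and the affine Grassmannian -/

/-- The solution `sol(A, b) = {u ∈ ℂⁿ | A u = b}`, an affine subspace of `ℂⁿ`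
(`⊥` is the empty one). -/
def sol {m n : ℕ} (A : Matrix (Fin m) (Fin n) ℂ) (b : EuclideanSpace ℂ (Fin m)) :
    AffineSubspace ℂ (EuclideanSpace ℂ (Fin n)) where
  carrier := {u | act A u = b}
  smul_vsub_vadd_mem' := by
    intro c p q r hp hq hr
    simp only [Set.mem_ofPred_eq, act] at hp hq hr ⊢
    rw [vsub_eq_sub, vadd_eq_add, map_add, map_smul, map_sub, hp, hq, hr, sub_self, smul_zero,
      zero_add]

open Classical in
/-- The dimension of an affine subspace, with the value `-1` for the empty set. -/
def dim {n : ℕ} (S : AffineSubspace ℂ (EuclideanSpace ℂ (Fin n))) : ℤ :=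
  if S = ⊥ then -1 else (Module.finrank ℂ S.direction : ℤ)

/-- The distance `‖P Pᴴ - Q Qᴴ‖₂` of two subspaces: the operator norm of the difference of the
orthogonal projections onto them. -/
def gDist {n : ℕ} (V W : Submodule ℂ (EuclideanSpace ℂ (Fin n))) : ℝ :=
  ‖V.starProjection - W.starProjection‖

open Classical in
/-- The point of minimum norm of a nonempty affine subspace `u + V`, that is, the unique element
of `V^⊥ ∩ (u + V)`; the value is `0` for the empty set. -/
def minNormPoint {n : ℕ} (S : AffineSubspace ℂ (EuclideanSpace ℂ (Fin n))) :
    EuclideanSpace ℂ (Fin n) :=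
  if h : (S : Set (EuclideanSpace ℂ (Fin n))).Nonempty then
    h.some - S.direction.starProjection h.some
  else 0

theorem minNormPoint_mem {n : ℕ} {S : AffineSubspace ℂ (EuclideanSpace ℂ (Fin n))}
    (h : (S : Set (EuclideanSpace ℂ (Fin n))).Nonempty) :
    minNormPoint S ∈ S ∧ minNormPoint S ∈ S.directionᗮ := by
  rw [minNormPoint, dif_pos h]
  refine ⟨?_, Submodule.sub_starProjection_mem_orthogonal _⟩
  have h2 := AffineSubspace.vadd_mem_of_mem_direction
    (S.direction.neg_mem (Submodule.starProjection_apply_mem S.direction h.some)) h.some_mem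
  rwa [vadd_eq_add, neg_add_eq_sub] at h2

theorem eq_minNormPoint {n : ℕ} {S : AffineSubspace ℂ (EuclideanSpace ℂ (Fin n))}
    {u : EuclideanSpace ℂ (Fin n)} (hu : u ∈ S) (hu' : u ∈ S.directionᗮ) :
    u = minNormPoint S := by
  obtain ⟨h1, h2⟩ := minNormPoint_mem ⟨u, hu⟩
  have h3 : u - minNormPoint S ∈ S.direction := AffineSubspace.vsub_mem_direction hu h1
  have h4 : u - minNormPoint S ∈ S.directionᗮ := Submodule.sub_mem _ hu' h2
  have h5 := Submodule.inner_right_of_mem_orthogonal h3 h4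
  exact sub_eq_zero.mp (inner_self_eq_zero.mp h5)

/-- The distance in the affine Grassmannian, for affine subspaces of the same dimension:
the maximum of the distance of the points of minimum norm and of the distance of the directions.
For two empty sets the value is `0`. -/
def affDist {n : ℕ} (S T : AffineSubspace ℂ (EuclideanSpace ℂ (Fin n))) : ℝ :=
  max ‖minNormPoint S - minNormPoint T‖ (gDist S.direction T.direction)

theorem affDist_bot {n : ℕ} :
    affDist (⊥ : AffineSubspace ℂ (EuclideanSpace ℂ (Fin n))) ⊥ = 0 := by
  simp [affDist, gDist]

/-! ### The general numerical solution -/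

/-- `‖(G, d) - (G_θ, d_θ)‖` for `H = G_θ` and `d_θ = G_θ G_θ† d`. -/
def backwardError {m n : ℕ} (G : Matrix (Fin m) (Fin n) ℂ) (d : EuclideanSpace ℂ (Fin m))
    (H : Matrix (Fin m) (Fin n) ℂ) : ℝ :=
  pairNorm (G - H) (d - rangeProj H d)

/-- `S` is the general numerical solution `sol_θ(G, d)` of `G x = d` within the error tolerance `θ`:
with `G_θ` the `θ`-projection of `G` and `d_θ = G_θ G_θ† d`, it is `sol(G_θ, d_θ)` if
`‖(G, d) - (G_θ, d_θ)‖ < θ`, and empty if `‖(G, d) - (G_θ, d_θ)‖ > θ`. No `S` qualifies if `θ` is a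
singular value of `G` or if `‖(G, d) - (G_θ, d_θ)‖ = θ`, where the solution is undefined. -/
def IsNumSol {m n : ℕ} (θ : ℝ) (G : Matrix (Fin m) (Fin n) ℂ) (d : EuclideanSpace ℂ (Fin m))
    (S : AffineSubspace ℂ (EuclideanSpace ℂ (Fin n))) : Prop :=
  ∃ H, IsThetaProj θ G H ∧
    ((backwardError G d H < θ ∧ S = sol H (rangeProj H d)) ∨
      (θ < backwardError G d H ∧ S = ⊥))

/-- `S` is the general numerical solution `sol_θ(G, d)`, which exists and is unique. -/
def IsTheNumSol {m n : ℕ} (θ : ℝ) (G : Matrix (Fin m) (Fin n) ℂ) (d : EuclideanSpace ℂ (Fin m))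
    (S : AffineSubspace ℂ (EuclideanSpace ℂ (Fin n))) : Prop :=
  IsNumSol θ G d S ∧ ∀ T, IsNumSol θ G d T → T = S

end

end SingularSystem

open SingularSystem

namespace SingularSystem

/-! ### Projections, and truncations described by the projections that reduce them. -/

section

variable {l m n : ℕ}

/-! ### The action of matrices on vectors -/

/-! A `θ`-projection `H` of `A` is used only through three facts: its range and row space reduce `A`
(`Reduces`), `‖A - H‖ < θ`, and `θ * ‖H†‖ < 1`. They express a spectral gap at `θ`. Wedin's
inequalities (`Reduces.norm_colGap_le`, `Reduces.norm_rowGap_le`) bound each gap between the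
projections of two truncations by the other gap plus the perturbation. The spectral gap makes this a
contraction (`Reduces.gaps_le`), so `H` is unique and its projections are Lipschitz in `A`.

That a nearby matrix has a `θ`-projection at all follows from `Reduces.singularValue_dichotomy`. It
splits a singular pair of the perturbed matrix along the projections of `H` and finds no singular
value near `θ`, with no minimax argument.

The solution set of the truncated system has minimum norm point `H† b`, and the projection onto its
direction is `1 - H† H`. Hence the affine distance is explicit (`affDist_sol`),
`Reduces.norm_pinv_sub_le` controls its first part and the gaps control the second. Dimensions agree
once the row projections are at distance less than 1.

Part (i) holds because `A` is its own `θ`-projection. Part (ii) adds that the backward error is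
continuous and differs from `θ`. In (iii)(a) the comparison is with `H = A`, where all constants
become explicit. Part (iii)(b) combines (i) and (ii), since only the empty set has dimension `-1`.
-/

theorem act_add (A : Matrix (Fin m) (Fin n) ℂ) (x y : EuclideanSpace ℂ (Fin n)) :
    act A (x + y) = act A x + act A y := map_add _ _ _

theorem act_sub (A : Matrix (Fin m) (Fin n) ℂ) (x y : EuclideanSpace ℂ (Fin n)) :
    act A (x - y) = act A x - act A y := map_sub _ _ _

theorem act_smul (A : Matrix (Fin m) (Fin n) ℂ) (c : ℂ) (x : EuclideanSpace ℂ (Fin n)) :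
    act A (c • x) = c • act A x := map_smul _ _ _

@[simp]
theorem act_zero (A : Matrix (Fin m) (Fin n) ℂ) : act A 0 = 0 := map_zero _

theorem add_act (A B : Matrix (Fin m) (Fin n) ℂ) (x : EuclideanSpace ℂ (Fin n)) :
    act (A + B) x = act A x + act B x := by simp [act]

theorem sub_act (A B : Matrix (Fin m) (Fin n) ℂ) (x : EuclideanSpace ℂ (Fin n)) :
    act (A - B) x = act A x - act B x := by simp [act]

@[simp]
theorem one_act (x : EuclideanSpace ℂ (Fin n)) : act 1 x = x := by
  simp [act]

theorem mul_act (A : Matrix (Fin l) (Fin m) ℂ) (B : Matrix (Fin m) (Fin n) ℂ)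
    (x : EuclideanSpace ℂ (Fin n)) : act (A * B) x = act A (act B x) := by
  simp [act]

theorem norm_act_le (A : Matrix (Fin m) (Fin n) ℂ) (x : EuclideanSpace ℂ (Fin n)) :
    ‖act A x‖ ≤ ‖A‖ * ‖x‖ := A.l2_opNorm_mulVec x

theorem inner_act_left (A : Matrix (Fin m) (Fin n) ℂ) (x : EuclideanSpace ℂ (Fin n))
    (y : EuclideanSpace ℂ (Fin m)) : inner ℂ (act A x) y = inner ℂ x (act Aᴴ y) := by
  rw [act, act, Matrix.toEuclideanLin_conjTranspose_eq_adjoint, LinearMap.adjoint_inner_right]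

/-! ### The projections `A A†` and `A† A` -/

/-- The orthogonal projection `A A†` onto the range of `A`. -/
noncomputable def colProj (A : Matrix (Fin m) (Fin n) ℂ) : Matrix (Fin m) (Fin m) ℂ := A * pinv A

/-- The orthogonal projection `A† A` onto the orthogonal complement of the kernel of `A`. -/
noncomputable def rowProj (A : Matrix (Fin m) (Fin n) ℂ) : Matrix (Fin n) (Fin n) ℂ := pinv A * A

theorem pinv_eq {A : Matrix (Fin m) (Fin n) ℂ} {X : Matrix (Fin n) (Fin m) ℂ}
    (h : IsMoorePenrose A X) : pinv A = X := (isMoorePenrose_pinv A).unique h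

theorem pinv_conjTranspose (A : Matrix (Fin m) (Fin n) ℂ) : pinv Aᴴ = (pinv A)ᴴ := by
  have h := isMoorePenrose_pinv A
  refine pinv_eq ⟨?_, ?_, ?_, ?_⟩
  · rw [← Matrix.conjTranspose_mul, ← Matrix.conjTranspose_mul, ← Matrix.mul_assoc,
      h.mul_mul_left]
  · rw [← Matrix.conjTranspose_mul, ← Matrix.conjTranspose_mul, ← Matrix.mul_assoc,
      h.mul_mul_right]
  · rw [← Matrix.conjTranspose_mul, Matrix.conjTranspose_conjTranspose, h.herm_right]
  · rw [← Matrix.conjTranspose_mul, Matrix.conjTranspose_conjTranspose, h.herm_left]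

theorem norm_pinv_conjTranspose (A : Matrix (Fin m) (Fin n) ℂ) : ‖pinv Aᴴ‖ = ‖pinv A‖ := by
  rw [pinv_conjTranspose, Matrix.l2_opNorm_conjTranspose]

variable (A : Matrix (Fin m) (Fin n) ℂ)

theorem colProj_mul : colProj A * A = A := (isMoorePenrose_pinv A).mul_mul_left

theorem mul_rowProj : A * rowProj A = A := by
  rw [rowProj, ← Matrix.mul_assoc]; exact (isMoorePenrose_pinv A).mul_mul_left

theorem rowProj_mul_pinv : rowProj A * pinv A = pinv A := (isMoorePenrose_pinv A).mul_mul_right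

theorem pinv_mul_colProj : pinv A * colProj A = pinv A := by
  rw [colProj, ← Matrix.mul_assoc]; exact (isMoorePenrose_pinv A).mul_mul_right

theorem isStarProjection_colProj : IsStarProjection (colProj A) :=
  ⟨by rw [IsIdempotentElem]; nth_rw 2 [colProj]; rw [← Matrix.mul_assoc, colProj_mul, colProj],
    (isMoorePenrose_pinv A).herm_left⟩

theorem isStarProjection_rowProj : IsStarProjection (rowProj A) :=
  ⟨by rw [IsIdempotentElem]; nth_rw 2 [rowProj]; rw [← Matrix.mul_assoc, rowProj_mul_pinv, rowProj],
    (isMoorePenrose_pinv A).herm_right⟩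

theorem colProj_conjTranspose : colProj Aᴴ = rowProj A := by
  rw [colProj, pinv_conjTranspose, ← Matrix.conjTranspose_mul]
  exact (isMoorePenrose_pinv A).herm_right

theorem rowProj_conjTranspose : rowProj Aᴴ = colProj A := by
  rw [rowProj, pinv_conjTranspose, ← Matrix.conjTranspose_mul]
  exact (isMoorePenrose_pinv A).herm_left

theorem rangeProj_eq (b : EuclideanSpace ℂ (Fin m)) : rangeProj A b = act (colProj A) b := by
  rw [rangeProj, colProj, mul_act]

variable {A}

theorem norm_le_one_of_isStarProjection {P : Matrix (Fin n) (Fin n) ℂ} (hP : IsStarProjection P) :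
    ‖P‖ ≤ 1 := by
  have h := Matrix.l2_opNorm_conjTranspose_mul_self P
  rw [show Pᴴ = P from hP.isSelfAdjoint, hP.isIdempotentElem.eq] at h
  by_contra! h1
  nlinarith

theorem norm_sq_eq_of_isStarProjection {P : Matrix (Fin n) (Fin n) ℂ} (hP : IsStarProjection P)
    (x : EuclideanSpace ℂ (Fin n)) : ‖x‖ ^ 2 = ‖act P x‖ ^ 2 + ‖act (1 - P) x‖ ^ 2 := by
  have h0 : inner ℂ (act P x) (act (1 - P) x) = 0 := by
    rw [inner_act_left, ← mul_act, show Pᴴ = P from hP.isSelfAdjoint, Matrix.mul_sub,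
      hP.isIdempotentElem.eq, Matrix.mul_one, sub_self]
    simp [act]
  have h1 : x = act P x + act (1 - P) x := by rw [← add_act, add_sub_cancel, one_act]
  have := norm_add_sq_eq_norm_sq_add_norm_sq_of_inner_eq_zero _ _ h0
  rw [← h1] at this
  nlinarith

theorem norm_le_of_forall {M : Matrix (Fin m) (Fin n) ℂ} {c : ℝ} (hc : 0 ≤ c)
    (h : ∀ x, ‖act M x‖ ≤ c * ‖x‖) : ‖M‖ ≤ c :=
  ContinuousLinearMap.opNorm_le_bound _ hc h

/-- The distance of two orthogonal projections is bounded by the two gaps. -/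
theorem norm_sub_le_of_isStarProjection {P Q : Matrix (Fin n) (Fin n) ℂ}
    (hP : IsStarProjection P) (hQ : IsStarProjection Q) {c : ℝ}
    (h1 : ‖(1 - P) * Q‖ ≤ c) (h2 : ‖(1 - Q) * P‖ ≤ c) : ‖P - Q‖ ≤ c := by
  have hc : 0 ≤ c := (norm_nonneg _).trans h1
  have h3 : ‖P * (1 - Q)‖ ≤ c := by
    rw [← Matrix.l2_opNorm_conjTranspose, Matrix.conjTranspose_mul, Matrix.conjTranspose_sub,
      Matrix.conjTranspose_one, show Pᴴ = P from hP.isSelfAdjoint,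
      show Qᴴ = Q from hQ.isSelfAdjoint]
    exact h2
  refine norm_le_of_forall hc fun x => ?_
  refine (sq_le_sq₀ (norm_nonneg _) (by positivity)).mp ?_
  rw [norm_sq_eq_of_isStarProjection hP, ← mul_act, ← mul_act]
  -- The two orthogonal components of `(P - Q) x` depend only on `(1 - Q) x` and `Q x`, whose
  -- squared norms add up to `‖x‖²`. This gives the constant `c` with no extra factor.
  have e1 : P * (P - Q) = P * (1 - Q) * (1 - Q) := by
    rw [Matrix.mul_assoc, hQ.one_sub.isIdempotentElem.eq, Matrix.mul_sub, Matrix.mul_sub,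
      hP.isIdempotentElem.eq, Matrix.mul_one]
  have e2 : (1 - P) * (P - Q) = -((1 - P) * Q * Q) := by
    rw [Matrix.mul_assoc, hQ.isIdempotentElem.eq, Matrix.mul_sub, hP.one_sub_mul_self, zero_sub]
  rw [e1, e2, mul_act, show act (-((1 - P) * Q * Q)) x = - act ((1 - P) * Q) (act Q x) by
    rw [← mul_act]; simp [act], norm_neg]
  have b1 := (norm_act_le (P * (1 - Q)) (act (1 - Q) x)).trans
    (mul_le_mul_of_nonneg_right h3 (norm_nonneg _))
  have b2 := (norm_act_le ((1 - P) * Q) (act Q x)).trans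
    (mul_le_mul_of_nonneg_right h1 (norm_nonneg _))
  have b3 := pow_le_pow_left₀ (norm_nonneg _) b1 2
  have b4 := pow_le_pow_left₀ (norm_nonneg _) b2 2
  rw [mul_pow, norm_sq_eq_of_isStarProjection hQ x]
  nlinarith

/-! ### Reducing truncations -/

/-- `H` is obtained from `A` by compressing to the range and to the row space of `H`,
which reduce `A`. -/
structure Reduces (A H : Matrix (Fin m) (Fin n) ℂ) : Prop where
  left : colProj H * A = H
  right : A * rowProj H = H

theorem reduces_self (A : Matrix (Fin m) (Fin n) ℂ) : Reduces A A := ⟨colProj_mul A, mul_rowProj A⟩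

variable {H A' H' : Matrix (Fin m) (Fin n) ℂ}

theorem Reduces.conjTranspose (h : Reduces A H) : Reduces Aᴴ Hᴴ := by
  constructor
  · rw [colProj_conjTranspose, ← show (rowProj H)ᴴ = rowProj H from
      (isStarProjection_rowProj H).isSelfAdjoint, ← Matrix.conjTranspose_mul, h.right]
  · rw [rowProj_conjTranspose, ← show (colProj H)ᴴ = colProj H from
      (isStarProjection_colProj H).isSelfAdjoint, ← Matrix.conjTranspose_mul, h.left]

theorem Reduces.sub_mul (h : Reduces A H) : (1 - colProj H) * A = A - H := by
  rw [Matrix.sub_mul, Matrix.one_mul, h.left]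

theorem Reduces.mul_sub (h : Reduces A H) : A * (1 - rowProj H) = A - H := by
  rw [Matrix.mul_sub, Matrix.mul_one, h.right]

theorem Reduces.sub_mul_one_sub (h : Reduces A H) : (A - H) * (1 - rowProj H) = A - H := by
  rw [Matrix.sub_mul, h.mul_sub, Matrix.mul_sub, mul_rowProj, Matrix.mul_one, sub_self, sub_zero]

theorem norm_mul_le_of_norm_le_one_left {P : Matrix (Fin l) (Fin m) ℂ} (hP : ‖P‖ ≤ 1)
    (M : Matrix (Fin m) (Fin n) ℂ) : ‖P * M‖ ≤ ‖M‖ :=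
  (Matrix.l2_opNorm_mul P M).trans (mul_le_of_le_one_left (norm_nonneg _) hP)

theorem norm_mul_le_of_norm_le_one_right {P : Matrix (Fin n) (Fin l) ℂ} (hP : ‖P‖ ≤ 1)
    (M : Matrix (Fin m) (Fin n) ℂ) : ‖M * P‖ ≤ ‖M‖ :=
  (Matrix.l2_opNorm_mul M P).trans (mul_le_of_le_one_right (norm_nonneg _) hP)

/-- Wedin's inequality for the left gap of two truncations. -/
theorem Reduces.norm_colGap_le (h : Reduces A H) (h' : Reduces A' H') :
    ‖(1 - colProj H) * colProj H'‖ ≤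
      ‖pinv H'‖ * (‖A - H‖ * ‖(1 - rowProj H) * rowProj H'‖ + ‖A' - A‖) := by
  -- Write `colProj H' = (A + (A' - A)) * pinv H'`. The complement of `colProj H` turns `A` into `A
  -- - H`, which factors through `1 - rowProj H`, and `pinv H'` factors through `rowProj H'`.
  have key : (1 - colProj H) * colProj H' =
      ((A - H) * ((1 - rowProj H) * rowProj H') + (1 - colProj H) * (A' - A)) * pinv H' := by
    have e1 : colProj H' = A' * pinv H' := by
      calc colProj H' = A' * rowProj H' * pinv H' := by rw [h'.right, colProj]
        _ = A' * pinv H' := by rw [Matrix.mul_assoc, rowProj_mul_pinv]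
    rw [Matrix.add_mul, Matrix.mul_assoc, Matrix.mul_assoc _ (rowProj H'), rowProj_mul_pinv,
      ← Matrix.mul_assoc, h.sub_mul_one_sub, ← h.sub_mul, Matrix.mul_assoc, Matrix.mul_assoc,
      ← Matrix.mul_add, ← Matrix.add_mul, add_sub_cancel, e1]
  rw [key, mul_comm ‖pinv H'‖]
  refine (Matrix.l2_opNorm_mul _ _).trans (mul_le_mul_of_nonneg_right ?_ (norm_nonneg _))
  refine (norm_add_le _ _).trans (add_le_add (Matrix.l2_opNorm_mul _ _) ?_)
  exact norm_mul_le_of_norm_le_one_left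
    (norm_le_one_of_isStarProjection (isStarProjection_colProj H).one_sub) _

/-- Wedin's inequality for the right gap of two truncations. -/
theorem Reduces.norm_rowGap_le (h : Reduces A H) (h' : Reduces A' H') :
    ‖(1 - rowProj H) * rowProj H'‖ ≤
      ‖pinv H'‖ * (‖A - H‖ * ‖(1 - colProj H) * colProj H'‖ + ‖A' - A‖) := by
  have := h.conjTranspose.norm_colGap_le h'.conjTranspose
  rwa [colProj_conjTranspose, colProj_conjTranspose, rowProj_conjTranspose, rowProj_conjTranspose,
    norm_pinv_conjTranspose, ← Matrix.conjTranspose_sub, ← Matrix.conjTranspose_sub,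
    Matrix.l2_opNorm_conjTranspose, Matrix.l2_opNorm_conjTranspose] at this

/-- The `sin Θ` theorem: both gaps are bounded by `c` when `‖H'†‖ (‖A - H‖ c + ‖A' - A‖) ≤ c`
with contraction factor `‖H'†‖ ‖A - H‖ < 1`. -/
theorem Reduces.gaps_le (h : Reduces A H) (h' : Reduces A' H') {c : ℝ}
    (h1 : ‖pinv H'‖ * ‖A - H‖ < 1) (hc : ‖pinv H'‖ * (‖A - H‖ * c + ‖A' - A‖) ≤ c) :
    ‖(1 - colProj H) * colProj H'‖ ≤ c ∧ ‖(1 - rowProj H) * rowProj H'‖ ≤ c := by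
  have g1 := h.norm_colGap_le h'
  have g2 := h.norm_rowGap_le h'
  set x := ‖(1 - colProj H) * colProj H'‖
  set y := ‖(1 - rowProj H) * rowProj H'‖
  have p0 : 0 ≤ ‖pinv H'‖ * ‖A - H‖ := by positivity
  -- The larger gap satisfies an inequality in itself alone; since the contraction factor is below
  -- 1, it cannot exceed `c`.
  rcases le_total x y with hxy | hxy
  · have : y ≤ c := by nlinarith
    exact ⟨hxy.trans this, this⟩
  · have : x ≤ c := by nlinarith
    exact ⟨this, hxy.trans this⟩

/-- A truncation is determined by the spectral gap at `θ`. -/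
theorem Reduces.eq_of_gap {θ : ℝ} (h : Reduces A H) (h' : Reduces A H')
    (h1 : ‖A - H‖ < θ) (h2 : θ * ‖pinv H‖ < 1) (h1' : ‖A - H'‖ < θ) (h2' : θ * ‖pinv H'‖ < 1) :
    H = H' := by
  have c1 : ‖pinv H'‖ * ‖A - H‖ < 1 := by nlinarith [norm_nonneg (pinv H')]
  have c2 : ‖pinv H‖ * ‖A - H'‖ < 1 := by nlinarith [norm_nonneg (pinv H)]
  -- With no perturbation the gap inequalities are homogeneous, so the bound `0` is admissible.
  have z1 := (h.gaps_le h' (c := 0) c1 (by simp)).1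
  have z2 := (h'.gaps_le h (c := 0) c2 (by simp)).1
  have := norm_sub_le_of_isStarProjection (isStarProjection_colProj H) (isStarProjection_colProj H')
    z1 z2
  rw [norm_le_zero_iff, sub_eq_zero] at this
  rw [← h.left, this, h'.left]

end

/-! ### Singular value decompositions and the truncations built from them. -/

section

variable {l m n : ℕ}

/-! ### Rectangular diagonal matrices -/

theorem rectDiag_conjTranspose (s : ℕ → ℝ) : (rectDiag m n s)ᴴ = rectDiag n m s := by
  ext i j
  by_cases h : (i : ℕ) = j
  · simp [rectDiag, h]
  · simp [rectDiag, h, Ne.symm h]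

/-- When the inner dimension `m` is smaller than `l` and `n`, the product has no diagonal entries
from index `m` on; `h` makes the right-hand side agree there. -/
theorem rectDiag_mul (s t : ℕ → ℝ) (h : ∀ k, m ≤ k → s k * t k = 0) :
    rectDiag l m s * rectDiag m n t = rectDiag l n (fun k => s k * t k) := by
  ext i j
  rw [Matrix.mul_apply]
  simp only [rectDiag, Matrix.of_apply]
  by_cases hi : (i : ℕ) < m
  · rw [Finset.sum_eq_single (⟨i, hi⟩ : Fin m)]
    · by_cases hij : (i : ℕ) = j <;> simp [hij]
    · intro k _ hk
      have : (i : ℕ) ≠ k := fun e => hk (Fin.ext e.symm)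
      simp [this]
    · simp
  · rw [Finset.sum_eq_zero]
    · rw [h _ (not_lt.mp hi)]; simp
    · intro k _
      have : (i : ℕ) ≠ k := fun e => hi (e ▸ k.2)
      simp [this]

theorem rectDiag_sub (s t : ℕ → ℝ) :
    rectDiag m n s - rectDiag m n t = rectDiag m n (fun k => s k - t k) := by
  ext i j
  by_cases h : (i : ℕ) = j <;> simp [rectDiag, h]

theorem rectDiag_self (s : ℕ → ℝ) :
    rectDiag n n s = Matrix.diagonal fun i : Fin n => ((s i : ℝ) : ℂ) := by
  ext i j
  simp [rectDiag, Matrix.diagonal_apply, Fin.ext_iff]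

/-- The C*-identity reduces the claim to the norm of a square diagonal matrix with entries `s k * s
k`. -/
theorem norm_rectDiag_le {s : ℕ → ℝ} (hs : ∀ k, min m n ≤ k → s k = 0) {c : ℝ} (hc : 0 ≤ c)
    (h : ∀ k, |s k| ≤ c) : ‖rectDiag m n s‖ ≤ c := by
  have h1 := Matrix.l2_opNorm_conjTranspose_mul_self (rectDiag m n s)
  rw [rectDiag_conjTranspose, rectDiag_mul, rectDiag_self, Matrix.l2_opNorm_diagonal] at h1
  · have h2 : ‖fun i : Fin n => (((s i * s i : ℝ)) : ℂ)‖ ≤ c * c := by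
      refine (pi_norm_le_iff_of_nonneg (by positivity)).mpr fun i => ?_
      rw [Complex.norm_real, norm_mul, Real.norm_eq_abs]
      exact mul_self_le_mul_self (abs_nonneg _) (h _)
    rw [h1] at h2
    exact abs_le_of_sq_le_sq' (by nlinarith) hc |>.2
  · intro k hk
    rw [hs k ((min_le_left _ _).trans hk), mul_zero]

theorem act_rectDiag_single (s : ℕ → ℝ) {k : ℕ} (hm : k < m) (hn : k < n) :
    act (rectDiag m n s) (EuclideanSpace.single ⟨k, hn⟩ 1) =
      (s k : ℂ) • EuclideanSpace.single ⟨k, hm⟩ 1 := by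
  ext i
  by_cases h : (i : ℕ) = k
  · subst h
    simp [act, rectDiag]
  · have : i ≠ ⟨k, hm⟩ := fun e => h (by rw [e])
    simp [act, rectDiag, h, this]

/-! ### Conjugation by unitary matrices -/

theorem conjTranspose_mul_of_mem {U : Matrix (Fin m) (Fin m) ℂ}
    (hU : U ∈ Matrix.unitaryGroup (Fin m) ℂ) : Uᴴ * U = 1 := Matrix.mem_unitaryGroup_iff'.mp hU

theorem mul_conjTranspose_of_mem {U : Matrix (Fin m) (Fin m) ℂ}
    (hU : U ∈ Matrix.unitaryGroup (Fin m) ℂ) : U * Uᴴ = 1 := Matrix.mem_unitaryGroup_iff.mp hU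

theorem norm_le_one_of_mem {U : Matrix (Fin m) (Fin m) ℂ}
    (hU : U ∈ Matrix.unitaryGroup (Fin m) ℂ) : ‖U‖ ≤ 1 := by
  have h := Matrix.l2_opNorm_conjTranspose_mul_self U
  rw [conjTranspose_mul_of_mem hU] at h
  have h1 : ‖(1 : Matrix (Fin m) (Fin m) ℂ)‖ ≤ 1 :=
    norm_le_one_of_isStarProjection (IsStarProjection.one _)
  nlinarith

theorem norm_conj_le {U : Matrix (Fin m) (Fin m) ℂ} {V : Matrix (Fin n) (Fin n) ℂ}
    (hU : U ∈ Matrix.unitaryGroup (Fin m) ℂ) (hV : V ∈ Matrix.unitaryGroup (Fin n) ℂ)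
    (D : Matrix (Fin m) (Fin n) ℂ) : ‖U * D * Vᴴ‖ ≤ ‖D‖ :=
  (norm_mul_le_of_norm_le_one_right
    (by rw [Matrix.l2_opNorm_conjTranspose]; exact norm_le_one_of_mem hV) _).trans
    (norm_mul_le_of_norm_le_one_left (norm_le_one_of_mem hU) _)

theorem norm_act_of_mem {U : Matrix (Fin m) (Fin m) ℂ}
    (hU : U ∈ Matrix.unitaryGroup (Fin m) ℂ) (x : EuclideanSpace ℂ (Fin m)) :
    ‖act U x‖ = ‖x‖ := by
  have h : inner ℂ (act U x) (act U x) = inner ℂ x x := by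
    rw [inner_act_left, ← mul_act, conjTranspose_mul_of_mem hU, one_act]
  rw [@norm_eq_sqrt_re_inner ℂ, @norm_eq_sqrt_re_inner ℂ _ _ _ _ x, h]

theorem conj_mul_conj {V : Matrix (Fin m) (Fin m) ℂ} (hV : V ∈ Matrix.unitaryGroup (Fin m) ℂ)
    (U : Matrix (Fin l) (Fin l) ℂ) (W : Matrix (Fin n) (Fin n) ℂ)
    (X : Matrix (Fin l) (Fin m) ℂ) (Y : Matrix (Fin m) (Fin n) ℂ) :
    U * X * Vᴴ * (V * Y * Wᴴ) = U * (X * Y) * Wᴴ := by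
  calc U * X * Vᴴ * (V * Y * Wᴴ) = U * X * (Vᴴ * V) * Y * Wᴴ := by simp only [Matrix.mul_assoc]
    _ = U * (X * Y) * Wᴴ := by
      rw [conjTranspose_mul_of_mem hV, Matrix.mul_one, Matrix.mul_assoc U X Y]

theorem conj_conjTranspose (U : Matrix (Fin m) (Fin m) ℂ) (V : Matrix (Fin n) (Fin n) ℂ)
    (D : Matrix (Fin m) (Fin n) ℂ) : (U * D * Vᴴ)ᴴ = V * Dᴴ * Uᴴ := by
  simp only [Matrix.conjTranspose_mul, Matrix.conjTranspose_conjTranspose, Matrix.mul_assoc]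

/-- The convention `0⁻¹ = 0` lets the entrywise inverse leave zero entries at zero, as a
pseudoinverse must. -/
theorem pinv_conj_rectDiag {U : Matrix (Fin m) (Fin m) ℂ} {V : Matrix (Fin n) (Fin n) ℂ}
    (hU : U ∈ Matrix.unitaryGroup (Fin m) ℂ) (hV : V ∈ Matrix.unitaryGroup (Fin n) ℂ)
    {t : ℕ → ℝ} (ht : ∀ k, min m n ≤ k → t k = 0) :
    pinv (U * rectDiag m n t * Vᴴ) = V * rectDiag n m (fun k => (t k)⁻¹) * Uᴴ := by
  have e1 : ∀ l, rectDiag l n t * rectDiag n m (fun k => (t k)⁻¹) =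
      rectDiag l m (fun k => t k * (t k)⁻¹) := fun l =>
    rectDiag_mul _ _ fun k hk => by rw [ht k ((min_le_right _ _).trans hk), zero_mul]
  have e2 : ∀ l, rectDiag l m (fun k => (t k)⁻¹) * rectDiag m n t =
      rectDiag l n (fun k => (t k)⁻¹ * t k) := fun l =>
    rectDiag_mul _ _ fun k hk => by rw [ht k ((min_le_left _ _).trans hk), mul_zero]
  refine pinv_eq ⟨?_, ?_, ?_, ?_⟩
  · rw [conj_mul_conj hV, conj_mul_conj hU, e1, rectDiag_mul]
    · simp only [mul_inv_mul_cancel]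
    · intro k hk
      rw [ht k ((min_le_left _ _).trans hk), mul_zero]
  · rw [conj_mul_conj hU, conj_mul_conj hV, e2, rectDiag_mul]
    · congr 3
      funext k
      by_cases h : t k = 0 <;> simp [h]
    · intro k hk
      rw [ht k ((min_le_right _ _).trans hk), inv_zero, mul_zero]
  · rw [conj_mul_conj hV, conj_conjTranspose, e1, rectDiag_conjTranspose]
  · rw [conj_mul_conj hU, conj_conjTranspose, e2, rectDiag_conjTranspose]

/-! ### Singular value decompositions -/

/-- The matrix whose columns are the vectors of an orthonormal basis. -/
noncomputable def colMatrix (w : OrthonormalBasis (Fin n) ℂ (EuclideanSpace ℂ (Fin n))) :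
    Matrix (Fin n) (Fin n) ℂ := Matrix.of fun i j => w j i

theorem colMatrix_mem (w : OrthonormalBasis (Fin n) ℂ (EuclideanSpace ℂ (Fin n))) :
    colMatrix w ∈ Matrix.unitaryGroup (Fin n) ℂ := by
  rw [Matrix.mem_unitaryGroup_iff', Matrix.star_eq_conjTranspose]
  ext i j
  have h := orthonormal_iff_ite.mp w.orthonormal i j
  rw [Matrix.mul_apply, Matrix.one_apply, ← h, PiLp.inner_apply]
  simp [colMatrix, mul_comm]

/-- Apply `A` to an orthonormal eigenbasis of `Aᴴ A`. The images are pairwise orthogonal with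
lengths the singular values; the nonzero ones are normalised and extended to an orthonormal basis of
the codomain. -/
theorem exists_isSVD (A : Matrix (Fin m) (Fin n) ℂ) : ∃ U s V, IsSVD A U s V := by
  set T := Matrix.toEuclideanLin A with hT
  have hn : Module.finrank ℂ (EuclideanSpace ℂ (Fin n)) = n := finrank_euclideanSpace_fin
  have hsym := T.isSymmetric_adjoint_comp_self
  set w := hsym.eigenvectorBasis hn with hw
  set s : ℕ → ℝ := ⇑T.singularValues with hs
  have hs0 : ∀ k, 0 ≤ s k := T.singularValues_nonneg
  have hsz : ∀ k, min m n ≤ k → s k = 0 := by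
    intro k hk
    refine T.singularValues_eq_zero_iff_le_finrank_range.mpr (le_trans (le_min ?_ ?_) hk)
    · simpa using Submodule.finrank_le T.range
    · simpa using T.finrank_range_le
  have hinner : ∀ i j : Fin n, inner ℂ (T (w i)) (T (w j)) =
      if i = j then ((s i : ℂ)) ^ 2 else 0 := by
    intro i j
    have e : T.adjoint (T (w j)) = ((s j ^ 2 : ℝ) : ℂ) • w j := by
      rw [hs, T.sq_singularValues_fin hn j]
      exact hsym.apply_eigenvectorBasis hn j
    rw [← LinearMap.adjoint_inner_right, e, inner_smul_right, orthonormal_iff_ite.mp w.orthonormal]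
    split_ifs with h
    · subst h; simp
    · simp
  -- Only indices with `0 < s i` matter, and these satisfy `i < n`; the default `0` is never used.
  set v : Fin m → EuclideanSpace ℂ (Fin m) := fun i =>
    if h : (i : ℕ) < n then ((s i : ℂ))⁻¹ • T (w ⟨i, h⟩) else 0 with hv
  have hlt : ∀ k, 0 < s k → k < n := fun k hk => by
    by_contra! h
    rw [hsz k ((min_le_right _ _).trans h)] at hk
    exact lt_irrefl _ hk
  have hort : Orthonormal ℂ (Set.domRestrict {i : Fin m | 0 < s i} v) := by
    rw [orthonormal_iff_ite]
    rintro ⟨i, hi⟩ ⟨j, hj⟩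
    have hi' : 0 < s i := hi
    have hj' : 0 < s j := hj
    simp only [Set.domRestrict_apply, hv, dif_pos (hlt _ hi'), dif_pos (hlt _ hj'),
      inner_smul_left, inner_smul_right, hinner, Subtype.mk.injEq, Fin.ext_iff]
    split_ifs with h
    · have : (s j : ℂ) ≠ 0 := by exact_mod_cast hj'.ne'
      simp only [h, map_inv₀, Complex.conj_ofReal]
      field_simp
    · simp
  obtain ⟨u, hu⟩ := hort.exists_orthonormalBasis_extension_of_card_eq (by simp)
  refine ⟨colMatrix u, s, colMatrix w, colMatrix_mem u, colMatrix_mem w, hs0,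
    T.singularValues_antitone, hsz, ?_⟩
  have key : A * colMatrix w = colMatrix u * rectDiag m n s := by
    ext i j
    have e1 : (A * colMatrix w) i j = T (w j) i := by
      simp [hT, Matrix.mul_apply, colMatrix, Matrix.mulVec, dotProduct]
    rw [e1, Matrix.mul_apply]
    by_cases hj : 0 < s j
    · have hjm : (j : ℕ) < m := by
        by_contra! h
        rw [hsz _ ((min_le_left _ _).trans h)] at hj
        exact lt_irrefl _ hj
      have hne : (s j : ℂ) ≠ 0 := by exact_mod_cast hj.ne'
      have e2 : T (w j) = (s j : ℂ) • u ⟨j, hjm⟩ := by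
        rw [hu ⟨j, hjm⟩ hj, hv]
        simp [hne, j.2]
      rw [Finset.sum_eq_single (⟨j, hjm⟩ : Fin m), e2]
      · simp [colMatrix, rectDiag, mul_comm]
      · intro k _ hk
        have : (k : ℕ) ≠ j := fun e => hk (Fin.ext e)
        simp [rectDiag, this]
      · simp
    · have hz : s j = 0 := le_antisymm (not_lt.mp hj) (hs0 _)
      have e2 : T (w j) = 0 := by
        rw [← inner_self_eq_zero (𝕜 := ℂ), hinner, if_pos rfl, hz]; simp
      rw [e2, Finset.sum_eq_zero]
      · rfl
      · intro k _
        by_cases h : (k : ℕ) = j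
        · simp [rectDiag, h, hz]
        · simp [rectDiag, h]
  rw [← key, Matrix.mul_assoc, mul_conjTranspose_of_mem (colMatrix_mem w), Matrix.mul_one]

variable {A H A' : Matrix (Fin m) (Fin n) ℂ} {U : Matrix (Fin m) (Fin m) ℂ} {s : ℕ → ℝ}
  {V : Matrix (Fin n) (Fin n) ℂ}

theorem IsSVD.conjTranspose (h : IsSVD A U s V) : IsSVD Aᴴ V s U :=
  ⟨h.unitary_right, h.unitary_left, h.nonneg, h.antitone,
    fun k hk => h.eq_zero k (by rwa [min_comm]), by
      rw [h.eq_mul, conj_conjTranspose, rectDiag_conjTranspose]⟩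

theorem IsSVD.act_right (h : IsSVD A U s V) {k : ℕ} (hm : k < m) (hn : k < n) :
    act A (act V (EuclideanSpace.single ⟨k, hn⟩ 1)) =
      (s k : ℂ) • act U (EuclideanSpace.single ⟨k, hm⟩ 1) := by
  rw [← mul_act, h.eq_mul, Matrix.mul_assoc, conjTranspose_mul_of_mem h.unitary_right,
    Matrix.mul_one, mul_act, act_rectDiag_single s hm hn, act_smul]

/-- A positive singular value has a pair of unit singular vectors. -/
theorem IsSVD.exists_pair (h : IsSVD A U s V) {k : ℕ} (hk : s k ≠ 0) :
    ∃ u v, ‖u‖ = 1 ∧ ‖v‖ = 1 ∧ act A v = (s k : ℂ) • u ∧ act Aᴴ u = (s k : ℂ) • v := by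
  have hk' : k < min m n := by
    by_contra! h'
    exact hk (h.eq_zero k h')
  obtain ⟨hm, hn⟩ := lt_min_iff.mp hk'
  exact ⟨_, _, by rw [norm_act_of_mem h.unitary_left]; simp,
    by rw [norm_act_of_mem h.unitary_right]; simp, h.act_right hm hn,
    h.conjTranspose.act_right hn hm⟩

/-! ### Truncations -/

/-- The truncation of a singular value decomposition to the singular values above `θ`. -/
noncomputable def truncation (θ : ℝ) (U : Matrix (Fin m) (Fin m) ℂ) (s : ℕ → ℝ)
    (V : Matrix (Fin n) (Fin n) ℂ) : Matrix (Fin m) (Fin n) ℂ :=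
  U * rectDiag m n (fun k => if θ < s k then s k else 0) * Vᴴ

variable {θ : ℝ}

theorem IsSVD.truncated_eq_zero (h : IsSVD A U s V) (k : ℕ) (hk : min m n ≤ k) :
    (if θ < s k then s k else 0) = 0 := by simp [h.eq_zero k hk]

theorem IsSVD.pinv_truncation (h : IsSVD A U s V) : pinv (truncation θ U s V) =
    V * rectDiag n m (fun k => (if θ < s k then s k else 0)⁻¹) * Uᴴ :=
  pinv_conj_rectDiag h.unitary_left h.unitary_right h.truncated_eq_zero

/-- In the singular bases both projections of the truncation are diagonal with entries 0 and 1. Here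
`0 < θ` ensures that the retained singular values are invertible. -/
theorem IsSVD.reduces_truncation (h : IsSVD A U s V) (hθ : 0 < θ) :
    Reduces A (truncation θ U s V) := by
  constructor
  · rw [colProj, h.pinv_truncation, truncation, conj_mul_conj h.unitary_right]
    rw [h.eq_mul]
    rw [conj_mul_conj h.unitary_left, rectDiag_mul, rectDiag_mul]
    · congr 3
      funext k
      split_ifs with hk
      · rw [mul_inv_cancel₀ (hθ.trans hk).ne', one_mul]
      · simp
    · intro k hk; rw [h.eq_zero k ((min_le_left _ _).trans hk), mul_zero]
    · intro k hk; simp [h.eq_zero k ((min_le_right _ _).trans hk)]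
  · rw [rowProj, h.pinv_truncation, truncation, conj_mul_conj h.unitary_left]
    rw [h.eq_mul]
    rw [conj_mul_conj h.unitary_right, rectDiag_mul, rectDiag_mul]
    · congr 3
      funext k
      split_ifs with hk
      · rw [inv_mul_cancel₀ (hθ.trans hk).ne', mul_one]
      · simp
    · intro k hk; simp [h.eq_zero k ((min_le_right _ _).trans hk)]
    · intro k hk; simp [h.eq_zero k ((min_le_left _ _).trans hk)]

theorem IsSVD.norm_sub_truncation_le (h : IsSVD A U s V) {c : ℝ} (hc : 0 ≤ c)
    (hs : ∀ k, s k ≤ θ → s k ≤ c) : ‖A - truncation θ U s V‖ ≤ c := by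
  have e : A - truncation θ U s V =
      U * rectDiag m n (fun k => s k - if θ < s k then s k else 0) * Vᴴ := by
    rw [truncation, ← rectDiag_sub, Matrix.mul_sub, Matrix.sub_mul, ← h.eq_mul]
  rw [e]
  refine (norm_conj_le h.unitary_left h.unitary_right _).trans (norm_rectDiag_le ?_ hc ?_)
  · intro k hk
    simp [h.eq_zero k hk]
  · intro k
    split_ifs with hk
    · simpa using hc
    · rw [sub_zero, abs_of_nonneg (h.nonneg k)]
      exact hs k (not_lt.mp hk)

theorem IsSVD.norm_pinv_truncation_le (h : IsSVD A U s V) {c : ℝ} (hc : 0 ≤ c)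
    (hs : ∀ k, θ < s k → (s k)⁻¹ ≤ c) : ‖pinv (truncation θ U s V)‖ ≤ c := by
  rw [h.pinv_truncation]
  refine (norm_conj_le h.unitary_right h.unitary_left _).trans (norm_rectDiag_le ?_ hc ?_)
  · intro k hk
    simp [h.eq_zero k (by rwa [min_comm])]
  · intro k
    split_ifs with hk
    · rw [abs_of_nonneg (inv_nonneg.mpr (h.nonneg k))]
      exact hs k hk
    · simpa using hc

theorem IsThetaProj.reduces (h : IsThetaProj θ A H) : Reduces A H := by
  obtain ⟨hθ, U, s, V, hs, -, rfl⟩ := h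
  exact hs.reduces_truncation hθ

theorem IsThetaProj.norm_sub_lt (h : IsThetaProj θ A H) : ‖A - H‖ < θ := by
  obtain ⟨hθ, U, s, V, hs, hne, rfl⟩ := h
  -- The first index below `θ` carries the largest discarded value, which makes the inequality
  -- strict. It exists because `s` vanishes from `min m n` on.
  have hex : ∃ k, s k < θ := ⟨min m n, by rwa [hs.eq_zero _ le_rfl]⟩
  classical
  refine (hs.norm_sub_truncation_le (c := s (Nat.find hex)) (hs.nonneg _) ?_).trans_lt
    (Nat.find_spec hex)
  intro k hk
  exact hs.antitone (Nat.find_min' hex (lt_of_le_of_ne hk (hne k)))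

theorem IsThetaProj.mul_norm_pinv_lt (h : IsThetaProj θ A H) : θ * ‖pinv H‖ < 1 := by
  obtain ⟨hθ, U, s, V, hs, hne, rfl⟩ := h
  have hex : ∃ k, s k < θ := ⟨min m n, by rwa [hs.eq_zero _ le_rfl]⟩
  classical
  have hlt : ∀ k, θ < s k → k < Nat.find hex := fun k hk => by
    by_contra! h
    exact lt_asymm ((hs.antitone h).trans_lt (Nat.find_spec hex)) hk
  -- Either nothing is retained and the pseudoinverse is zero, or `s K`, just before the first value
  -- below `θ`, is the smallest retained value.
  rcases hK : Nat.find hex with _ | K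
  · have := hs.norm_pinv_truncation_le (θ := θ) (c := 0) le_rfl fun k hk => by
      have := hlt k hk; omega
    rw [show ‖pinv (U * rectDiag m n (fun k => if θ < s k then s k else 0) * Vᴴ)‖ = 0 from
      le_antisymm this (norm_nonneg _)]
    simp
  · have hsK : θ < s K := lt_of_le_of_ne
      (not_lt.mp (Nat.find_min hex (by omega))) (hne K).symm
    have hpos := hθ.trans hsK
    have := hs.norm_pinv_truncation_le (θ := θ) (c := (s K)⁻¹) (inv_nonneg.mpr hpos.le)
      fun k hk => inv_anti₀ hpos (hs.antitone (by have := hlt k hk; omega))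
    refine (mul_le_mul_of_nonneg_left this hθ.le).trans_lt ?_
    rw [← div_eq_mul_inv, div_lt_one hpos]
    exact hsK

theorem IsThetaProj.unique {H' : Matrix (Fin m) (Fin n) ℂ} (h : IsThetaProj θ A H)
    (h' : IsThetaProj θ A H') : H = H' :=
  h.reduces.eq_of_gap h'.reduces h.norm_sub_lt h.mul_norm_pinv_lt h'.norm_sub_lt
    h'.mul_norm_pinv_lt

end

/-! ### Perturbation of singular values, solution sets and minimum norm solutions. -/

section

variable {m n : ℕ} {A A' H : Matrix (Fin m) (Fin n) ℂ} {θ : ℝ}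

/-! ### Perturbation of singular values -/

/-- Project `A v = σ u - (A' - A) v` onto the range of `H`, where `A` acts as `H`, and invert there
by `pinv H`. -/
theorem Reduces.norm_rowProj_act_le (h : Reduces A H) {σ : ℝ} (hσ : 0 ≤ σ)
    {u : EuclideanSpace ℂ (Fin m)} {v : EuclideanSpace ℂ (Fin n)}
    (huv : act A' v = (σ : ℂ) • u) :
    ‖act (rowProj H) v‖ ≤
      ‖pinv H‖ * (σ * ‖act (colProj H) u‖ + ‖act (colProj H) (act (A' - A) v)‖) := by
  have e : act (rowProj H) v = act (pinv H)
      ((σ : ℂ) • act (colProj H) u - act (colProj H) (act (A' - A) v)) := by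
    rw [← act_smul, ← huv, ← act_sub, sub_act, sub_sub_cancel, ← mul_act _ A, h.left, rowProj,
      mul_act]
  rw [e]
  refine (norm_act_le _ _).trans (mul_le_mul_of_nonneg_left ?_ (norm_nonneg _))
  refine (norm_sub_le _ _).trans_eq ?_
  rw [norm_smul, Complex.norm_real, Real.norm_of_nonneg hσ]

/-- The complementary component of the same equation, where `A` acts as the small matrix `A - H`. -/
theorem Reduces.mul_norm_compl_act_le (h : Reduces A H) {σ : ℝ} (hσ : 0 ≤ σ)
    {u : EuclideanSpace ℂ (Fin m)} {v : EuclideanSpace ℂ (Fin n)}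
    (huv : act A' v = (σ : ℂ) • u) :
    σ * ‖act (1 - colProj H) u‖ ≤
      ‖A - H‖ * ‖act (1 - rowProj H) v‖ + ‖act (1 - colProj H) (act (A' - A) v)‖ := by
  have e : (σ : ℂ) • act (1 - colProj H) u = act (A - H) (act (1 - rowProj H) v) +
      act (1 - colProj H) (act (A' - A) v) := by
    rw [← mul_act, h.sub_mul_one_sub, ← h.sub_mul, mul_act, ← act_add, ← add_act, add_sub_cancel,
      huv, act_smul]
  have e' := congrArg norm e
  rw [norm_smul, Complex.norm_real, Real.norm_of_nonneg hσ] at e'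
  rw [e']
  exact (norm_add_le _ _).trans (add_le_add (norm_act_le _ _) le_rfl)

/-- Here `a` and `c` stand for the component norms of the singular vectors `u` and `v`, and `p` and
`q` for those of the perturbation applied to `v` and of its adjoint applied to `u`. If both
alternatives failed, `σ` would have a margin `g > e` from both parts of the spectrum. Weighting the
four inequalities by components and adding gives `2g ≤ p·c + q·a`, while Cauchy-Schwarz bounds the
right side by `2e`. -/
theorem dichotomy_of_le {a₁ a₂ c₁ c₂ p₁ p₂ q₁ q₂ h lo e σ : ℝ}
    (ha : a₁ ^ 2 + a₂ ^ 2 = 1) (hc : c₁ ^ 2 + c₂ ^ 2 = 1)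
    (ha₁ : 0 ≤ a₁) (ha₂ : 0 ≤ a₂) (hc₁ : 0 ≤ c₁) (hc₂ : 0 ≤ c₂) (hh : 0 ≤ h) (hlo : 0 ≤ lo)
    (he : 0 ≤ e) (hp : p₁ ^ 2 + p₂ ^ 2 ≤ e ^ 2) (hq : q₁ ^ 2 + q₂ ^ 2 ≤ e ^ 2)
    (i₁ : c₁ ≤ h * (σ * a₁ + p₁)) (i₂ : a₁ ≤ h * (σ * c₁ + q₁))
    (i₃ : σ * a₂ ≤ lo * c₂ + p₂) (i₄ : σ * c₂ ≤ lo * a₂ + q₂) :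
    σ ≤ lo + e ∨ 1 ≤ h * (σ + e) := by
  by_contra! hcon
  obtain ⟨h1, h2⟩ := hcon
  have hσ : 0 < σ := by linarith
  -- The margin is the smaller of `σ - lo` and `1 / h - σ`; for `h = 0` there is no upper part and
  -- the second constraint is void.
  obtain ⟨g, hge, hg1, hg2⟩ : ∃ g, e < g ∧ g ≤ σ - lo ∧ h * (g + σ) ≤ 1 := by
    rcases hh.eq_or_lt with h0 | h0
    · exact ⟨σ - lo, by linarith, le_rfl, by rw [← h0]; simp⟩
    · refine ⟨min (1 / h - σ) (σ - lo), lt_min ?_ (by linarith), min_le_right _ _, ?_⟩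
      · rw [lt_sub_iff_add_lt, lt_div_iff₀ h0]; linarith
      · have := min_le_left (1 / h - σ) (σ - lo)
        calc h * (min (1 / h - σ) (σ - lo) + σ) ≤ h * (1 / h) :=
              mul_le_mul_of_nonneg_left (by linarith) hh
          _ = 1 := by field_simp
  have k1 : g * (a₁ ^ 2 + c₁ ^ 2) ≤ p₁ * c₁ + q₁ * a₁ := by
    have j1 : c₁ ^ 2 + a₁ ^ 2 ≤ h * (2 * σ * (a₁ * c₁) + (p₁ * c₁ + q₁ * a₁)) := by
      linarith [mul_le_mul_of_nonneg_right i₁ hc₁, mul_le_mul_of_nonneg_right i₂ ha₁]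
    have j2 : h * σ * (2 * (a₁ * c₁)) ≤ h * σ * (a₁ ^ 2 + c₁ ^ 2) :=
      mul_le_mul_of_nonneg_left (by nlinarith [sq_nonneg (a₁ - c₁)]) (by positivity)
    have j3 := mul_le_mul_of_nonneg_right hg2 (by positivity : 0 ≤ a₁ ^ 2 + c₁ ^ 2)
    rcases hh.eq_or_lt with h0 | h0
    · rw [← h0] at i₁ i₂
      have z1 : c₁ = 0 := by linarith
      have z2 : a₁ = 0 := by linarith
      simp [z1, z2]
    · refine le_of_mul_le_mul_left ?_ h0
      linarith
  have k2 : g * (a₂ ^ 2 + c₂ ^ 2) ≤ p₂ * a₂ + q₂ * c₂ := by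
    have j1 : σ * (a₂ ^ 2 + c₂ ^ 2) ≤ lo * (2 * (a₂ * c₂)) + (p₂ * a₂ + q₂ * c₂) := by
      linarith [mul_le_mul_of_nonneg_right i₃ ha₂, mul_le_mul_of_nonneg_right i₄ hc₂]
    have j2 : lo * (2 * (a₂ * c₂)) ≤ lo * (a₂ ^ 2 + c₂ ^ 2) :=
      mul_le_mul_of_nonneg_left (by nlinarith [sq_nonneg (a₂ - c₂)]) hlo
    have j3 := mul_le_mul_of_nonneg_right hg1 (by positivity : 0 ≤ a₂ ^ 2 + c₂ ^ 2)
    linarith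
  have hg : 0 < g := he.trans_lt hge
  have k3 : 2 * g ≤ p₁ * c₁ + q₁ * a₁ + p₂ * a₂ + q₂ * c₂ := by
    have : g * (a₁ ^ 2 + c₁ ^ 2) + g * (a₂ ^ 2 + c₂ ^ 2) = 2 * g := by
      linear_combination g * ha + g * hc
    linarith
  -- Cauchy-Schwarz in the form of four squares, weighted by `g`.
  have k4 : 2 * g * (p₁ * c₁ + q₁ * a₁ + p₂ * a₂ + q₂ * c₂) ≤ 2 * e ^ 2 + g ^ 2 * 2 := by
    have : g ^ 2 * (a₁ ^ 2 + a₂ ^ 2) + g ^ 2 * (c₁ ^ 2 + c₂ ^ 2) = g ^ 2 * 2 := by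
      rw [ha, hc]; ring
    linarith [sq_nonneg (p₁ - g * c₁), sq_nonneg (q₁ - g * a₁), sq_nonneg (p₂ - g * a₂),
      sq_nonneg (q₂ - g * c₂)]
  have k5 := mul_le_mul_of_nonneg_left k3 hg.le
  have k6 := pow_lt_pow_left₀ hge he two_ne_zero
  linarith

/-- Every singular value of a perturbed matrix is either small or large. -/
theorem Reduces.singularValue_dichotomy (h : Reduces A H) {σ : ℝ} (hσ : 0 ≤ σ)
    {u : EuclideanSpace ℂ (Fin m)} {v : EuclideanSpace ℂ (Fin n)} (hu : ‖u‖ = 1) (hv : ‖v‖ = 1)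
    (huv : act A' v = (σ : ℂ) • u) (hvu : act A'ᴴ u = (σ : ℂ) • v) :
    σ ≤ ‖A - H‖ + ‖A' - A‖ ∨ 1 ≤ ‖pinv H‖ * (σ + ‖A' - A‖) := by
  have hc := isStarProjection_colProj H
  have hr := isStarProjection_rowProj H
  have eE : ‖(A'ᴴ - Aᴴ)‖ = ‖A' - A‖ := by
    rw [← Matrix.conjTranspose_sub, Matrix.l2_opNorm_conjTranspose]
  have eH : ‖(Aᴴ - Hᴴ)‖ = ‖A - H‖ := by
    rw [← Matrix.conjTranspose_sub, Matrix.l2_opNorm_conjTranspose]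
  have i₂ := h.conjTranspose.norm_rowProj_act_le hσ hvu
  have i₄ := h.conjTranspose.mul_norm_compl_act_le hσ hvu
  rw [rowProj_conjTranspose, colProj_conjTranspose, norm_pinv_conjTranspose] at i₂
  rw [rowProj_conjTranspose, colProj_conjTranspose, eH] at i₄
  refine dichotomy_of_le (by rw [← norm_sq_eq_of_isStarProjection hc, hu, one_pow])
    (by rw [← norm_sq_eq_of_isStarProjection hr, hv, one_pow])
    (norm_nonneg _) (norm_nonneg _) (norm_nonneg _) (norm_nonneg _) (norm_nonneg _)
    (norm_nonneg _) (norm_nonneg _) ?_ ?_ (h.norm_rowProj_act_le hσ huv) i₂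
    (h.mul_norm_compl_act_le hσ huv) i₄
  · rw [← norm_sq_eq_of_isStarProjection hc]
    have := norm_act_le (A' - A) v
    rw [hv, mul_one] at this
    exact pow_le_pow_left₀ (norm_nonneg _) this 2
  · rw [← norm_sq_eq_of_isStarProjection hr]
    have := norm_act_le (A'ᴴ - Aᴴ) u
    rw [hu, mul_one, eE] at this
    exact pow_le_pow_left₀ (norm_nonneg _) this 2

/-- A spectral gap at `θ` survives small perturbations. -/
theorem Reduces.exists_isThetaProj (h : Reduces A H) (h1 : ‖A - H‖ + ‖A' - A‖ < θ)
    (h2 : (θ + ‖A' - A‖) * ‖pinv H‖ < 1) :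
    ∃ H', IsThetaProj θ A' H' ∧ ‖A' - H'‖ ≤ ‖A - H‖ + ‖A' - A‖ ∧
      ‖pinv H'‖ * (1 - ‖pinv H‖ * ‖A' - A‖) ≤ ‖pinv H‖ := by
  obtain ⟨U, s, V, hs⟩ := exists_isSVD A'
  have hlo : 0 ≤ ‖A - H‖ + ‖A' - A‖ := by positivity
  have hθ : 0 < θ := hlo.trans_lt h1
  have hpos : 0 < 1 - ‖pinv H‖ * ‖A' - A‖ := by nlinarith [norm_nonneg (pinv H)]
  have hdich : ∀ k, s k ≤ ‖A - H‖ + ‖A' - A‖ ∨ 1 ≤ ‖pinv H‖ * (s k + ‖A' - A‖) := by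
    intro k
    by_cases hk : s k = 0
    · left; rwa [hk]
    · obtain ⟨u, v, hu, hv, huv, hvu⟩ := hs.exists_pair hk
      exact h.singularValue_dichotomy (hs.nonneg k) hu hv huv hvu
  -- The two alternatives of the dichotomy thus lie on opposite sides of `θ`, so truncation at `θ`
  -- separates them.
  have hbig : ∀ k, 1 ≤ ‖pinv H‖ * (s k + ‖A' - A‖) → θ < s k := fun k hk => by
    by_contra! hle
    nlinarith [mul_le_mul_of_nonneg_left hle (norm_nonneg (pinv H))]
  refine ⟨truncation θ U s V, ⟨hθ, U, s, V, hs, ?_, rfl⟩, hs.norm_sub_truncation_le hlo ?_, ?_⟩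
  · intro k
    rcases hdich k with hk | hk
    · exact (hk.trans_lt h1).ne
    · exact (hbig k hk).ne'
  · intro k hk
    exact (hdich k).resolve_right fun h' => (hbig k h').not_ge hk
  · rw [← le_div_iff₀ hpos]
    refine hs.norm_pinv_truncation_le (by positivity) fun k hk => ?_
    have := (hdich k).resolve_left fun h' => (h'.trans_lt h1).not_gt hk
    rw [inv_eq_one_div, div_le_div_iff₀ (hθ.trans hk) hpos]
    nlinarith

/-! ### Solution sets -/

theorem mem_sol {b : EuclideanSpace ℂ (Fin m)} {x : EuclideanSpace ℂ (Fin n)} :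
    x ∈ sol A b ↔ act A x = b := Iff.rfl

theorem pinv_mem_sol (b : EuclideanSpace ℂ (Fin m)) :
    act (pinv H) b ∈ sol H (rangeProj H b) := rfl

theorem rangeProj_of_mem {b : EuclideanSpace ℂ (Fin m)} (hb : b ∈ matRange A) :
    rangeProj A b = b := by
  obtain ⟨x, rfl⟩ := hb
  rw [rangeProj_eq, ← act, ← mul_act, colProj_mul]

theorem sol_eq_bot_iff {b : EuclideanSpace ℂ (Fin m)} : sol A b = ⊥ ↔ b ∉ matRange A := by
  constructor
  · rintro h ⟨x, hx⟩
    have : x ∈ sol A b := hx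
    rw [h] at this
    exact AffineSubspace.notMem_bot _ _ _ this
  · intro h
    rw [eq_bot_iff]
    intro x hx
    exact (h ⟨x, hx⟩).elim

theorem sol_ne_bot (b : EuclideanSpace ℂ (Fin m)) : sol H (rangeProj H b) ≠ ⊥ := by
  intro h
  have := pinv_mem_sol (H := H) b
  rw [h] at this
  exact AffineSubspace.notMem_bot _ _ _ this

theorem direction_sol (b : EuclideanSpace ℂ (Fin m)) :
    (sol H (rangeProj H b)).direction = LinearMap.ker (Matrix.toEuclideanLin H) := by
  ext x
  rw [LinearMap.mem_ker, ← AffineSubspace.vadd_mem_iff_mem_direction x (pinv_mem_sol b), mem_sol,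
    vadd_eq_add, act_add, rangeProj]
  exact add_eq_right

theorem act_eq_zero_of_mem_ker {x : EuclideanSpace ℂ (Fin n)}
    (hx : x ∈ LinearMap.ker (Matrix.toEuclideanLin H)) : act (rowProj H) x = 0 := by
  rw [rowProj, mul_act, show act H x = 0 from hx, act_zero]

theorem act_rowProj_mem_orthogonal (x : EuclideanSpace ℂ (Fin n)) :
    act (rowProj H) x ∈ (LinearMap.ker (Matrix.toEuclideanLin H))ᗮ := by
  rw [Submodule.mem_orthogonal']
  intro y hy
  rw [inner_act_left, show (rowProj H)ᴴ = rowProj H from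
    (isStarProjection_rowProj H).isSelfAdjoint, act_eq_zero_of_mem_ker hy, inner_zero_right]

/-- The vector `H† b = (H† H) H† b` lies in the row space, hence is orthogonal to the kernel. -/
theorem minNormPoint_sol (b : EuclideanSpace ℂ (Fin m)) :
    minNormPoint (sol H (rangeProj H b)) = act (pinv H) b := by
  refine (eq_minNormPoint (pinv_mem_sol b) ?_).symm
  rw [direction_sol, ← rowProj_mul_pinv, mul_act]
  exact act_rowProj_mem_orthogonal _

theorem starProjection_ker : (LinearMap.ker (Matrix.toEuclideanLin H)).starProjection =
    Matrix.toEuclideanCLM (n := Fin n) (𝕜 := ℂ) (1 - rowProj H) := by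
  ext1 x
  refine Submodule.eq_starProjection_of_mem_orthogonal
    (K := LinearMap.ker (Matrix.toEuclideanLin H)) (v := act (1 - rowProj H) x) ?_ ?_
  · rw [LinearMap.mem_ker, ← act, ← mul_act, Matrix.mul_sub, mul_rowProj, Matrix.mul_one, sub_self]
    simp [act]
  · rw [sub_act, one_act, sub_sub_cancel]
    exact act_rowProj_mem_orthogonal x

theorem gDist_ker (H H' : Matrix (Fin m) (Fin n) ℂ) :
    gDist (LinearMap.ker (Matrix.toEuclideanLin H)) (LinearMap.ker (Matrix.toEuclideanLin H')) =
      ‖rowProj H - rowProj H'‖ := by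
  rw [gDist, starProjection_ker, starProjection_ker, ← map_sub, sub_sub_sub_cancel_left,
    Matrix.l2_opNorm_toEuclideanCLM, norm_sub_rev]

/-- The projection onto `W` is injective on `V`: an `x` in `V` that it kills satisfies `‖x‖ = ‖(P_V
- P_W) x‖ ≤ gDist V W * ‖x‖`. -/
theorem finrank_le_of_gDist_lt {V W : Submodule ℂ (EuclideanSpace ℂ (Fin n))}
    (h : gDist V W < 1) : Module.finrank ℂ V ≤ Module.finrank ℂ W := by
  refine LinearMap.finrank_le_finrank_of_injective
    (f := W.orthogonalProjectionOnto.toLinearMap ∘ₗ V.subtype) ?_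
  rw [← LinearMap.ker_eq_bot, LinearMap.ker_eq_bot']
  rintro ⟨x, hx⟩ h0
  have h1 : W.starProjection x = 0 := by
    have := congrArg Subtype.val h0
    simpa using this
  have h2 := (V.starProjection - W.starProjection).le_opNorm x
  rw [sub_apply, h1, sub_zero,
    Submodule.starProjection_eq_self_iff.mpr hx] at h2
  have h3 : ‖x‖ = 0 := by
    rw [gDist] at h
    by_contra h4
    have := lt_of_le_of_ne (norm_nonneg x) (Ne.symm h4)
    nlinarith
  simpa using norm_eq_zero.mp h3

theorem gDist_comm (V W : Submodule ℂ (EuclideanSpace ℂ (Fin n))) : gDist V W = gDist W V :=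
  norm_sub_rev _ _

theorem dim_sol_eq {H H' : Matrix (Fin m) (Fin n) ℂ} (b b' : EuclideanSpace ℂ (Fin m))
    (h : ‖rowProj H - rowProj H'‖ < 1) :
    dim (sol H (rangeProj H b)) = dim (sol H' (rangeProj H' b')) := by
  rw [dim, dim, if_neg (sol_ne_bot b), if_neg (sol_ne_bot b'), direction_sol, direction_sol]
  rw [← gDist_ker] at h
  exact congrArg _ (le_antisymm (finrank_le_of_gDist_lt h)
    (finrank_le_of_gDist_lt (by rwa [gDist_comm])))

theorem affDist_sol (H H' : Matrix (Fin m) (Fin n) ℂ) (b b' : EuclideanSpace ℂ (Fin m)) :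
    affDist (sol H (rangeProj H b)) (sol H' (rangeProj H' b')) =
      max ‖act (pinv H) b - act (pinv H') b'‖ ‖rowProj H - rowProj H'‖ := by
  rw [affDist, minNormPoint_sol, minNormPoint_sol, direction_sol, direction_sol, gDist_ker]

theorem IsNumSol.unique {b : EuclideanSpace ℂ (Fin m)}
    {S T : AffineSubspace ℂ (EuclideanSpace ℂ (Fin n))} (hS : IsNumSol θ A b S)
    (hT : IsNumSol θ A b T) : T = S := by
  obtain ⟨H, hH, h⟩ := hS
  obtain ⟨H', hH', h'⟩ := hT
  obtain rfl := hH.unique hH'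
  rcases h with ⟨h1, rfl⟩ | ⟨h1, rfl⟩ <;> rcases h' with ⟨h2, rfl⟩ | ⟨h2, rfl⟩
  · rfl
  · exact absurd h1 h2.not_gt
  · exact absurd h1 h2.not_gt
  · rfl

theorem IsNumSol.isTheNumSol {b : EuclideanSpace ℂ (Fin m)}
    {S : AffineSubspace ℂ (EuclideanSpace ℂ (Fin n))} (hS : IsNumSol θ A b S) :
    IsTheNumSol θ A b S := ⟨hS, fun _ hT => hS.unique hT⟩

/-! ### The norm on pairs -/

/-- This makes the reverse triangle inequality of a normed space available for `pairNorm`. -/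
theorem pairNorm_eq (M : Matrix (Fin m) (Fin n) ℂ) (b : EuclideanSpace ℂ (Fin m)) :
    pairNorm M b = ‖WithLp.toLp 2 (M, b)‖ := by
  rw [WithLp.prod_norm_eq_of_L2]; rfl

theorem pairNorm_nonneg (M : Matrix (Fin m) (Fin n) ℂ) (b : EuclideanSpace ℂ (Fin m)) :
    0 ≤ pairNorm M b := Real.sqrt_nonneg _

theorem norm_le_pairNorm (M : Matrix (Fin m) (Fin n) ℂ) (b : EuclideanSpace ℂ (Fin m)) :
    ‖M‖ ≤ pairNorm M b := Real.le_sqrt_of_sq_le (by nlinarith [sq_nonneg ‖b‖])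

theorem norm_le_pairNorm' (M : Matrix (Fin m) (Fin n) ℂ) (b : EuclideanSpace ℂ (Fin m)) :
    ‖b‖ ≤ pairNorm M b := Real.le_sqrt_of_sq_le (by nlinarith [sq_nonneg ‖M‖])

theorem pairNorm_le_add (M : Matrix (Fin m) (Fin n) ℂ) (b : EuclideanSpace ℂ (Fin m)) :
    pairNorm M b ≤ ‖M‖ + ‖b‖ :=
  Real.sqrt_le_iff.mpr ⟨by positivity, by nlinarith [norm_nonneg M, norm_nonneg b]⟩

theorem abs_pairNorm_sub_le (M M' : Matrix (Fin m) (Fin n) ℂ) (b b' : EuclideanSpace ℂ (Fin m)) :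
    |pairNorm M b - pairNorm M' b'| ≤ ‖M - M'‖ + ‖b - b'‖ := by
  refine le_trans ?_ (pairNorm_le_add (M - M') (b - b'))
  rw [pairNorm_eq, pairNorm_eq, pairNorm_eq]
  exact abs_norm_sub_norm_le _ _

/-- Cauchy-Schwarz for the pair norm. -/
theorem add_le_sqrt_mul_pairNorm (M : Matrix (Fin m) (Fin n) ℂ) (b : EuclideanSpace ℂ (Fin m))
    (t : ℝ) : 2 * t * ‖M‖ + ‖b‖ ≤ Real.sqrt (4 * t ^ 2 + 1) * pairNorm M b := by
  rw [pairNorm, ← Real.sqrt_mul (by positivity)]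
  refine Real.le_sqrt_of_sq_le ?_
  nlinarith [sq_nonneg (2 * t * ‖b‖ - ‖M‖)]

/-! ### Perturbation of minimum norm solutions -/

variable {H' : Matrix (Fin m) (Fin n) ℂ}

/-- The difference splits exactly into three errors: rotation of the row space, perturbed data seen
through `pinv H'`, and leakage of the residual of `b` into the new range. The last vanishes when `b`
lies in the range of `H`. -/
theorem Reduces.norm_pinv_sub_le (h : Reduces A H) (h' : Reduces A' H')
    (b b' : EuclideanSpace ℂ (Fin m)) :
    ‖act (pinv H') b' - act (pinv H) b‖ ≤
      ‖(1 - rowProj H') * rowProj H‖ * ‖act (pinv H) b‖ +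
        ‖pinv H'‖ * (‖b' - b‖ + ‖A' - A‖ * ‖act (pinv H) b‖) +
        ‖pinv H'‖ * (‖(1 - colProj H) * colProj H'‖ * ‖b - rangeProj H b‖) := by
  set x := act (pinv H) b with hx
  have hQx : act (rowProj H) x = x := by rw [hx, ← mul_act, rowProj_mul_pinv]
  have hAx : act A x = act (colProj H) b := by
    rw [← hQx, ← mul_act, h.right, hx, ← mul_act, ← colProj]
  have hA' : pinv H' * A' = rowProj H' := by
    rw [← pinv_mul_colProj, Matrix.mul_assoc, h'.left, rowProj]
  have hcc : colProj H' * (1 - colProj H) = ((1 - colProj H) * colProj H')ᴴ := by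
    rw [Matrix.conjTranspose_mul, Matrix.conjTranspose_sub, Matrix.conjTranspose_one,
      show (colProj H)ᴴ = colProj H from (isStarProjection_colProj H).isSelfAdjoint,
      show (colProj H')ᴴ = colProj H' from (isStarProjection_colProj H').isSelfAdjoint]
  have hbb : b - rangeProj H b = act (1 - colProj H) (b - rangeProj H b) := by
    have hi := (isStarProjection_colProj H).one_sub.isIdempotentElem.eq
    rw [rangeProj_eq]
    nth_rw 1 3 [← one_act b]
    rw [← sub_act, ← mul_act, hi]
  have key : act (pinv H') b' - x = -act ((1 - rowProj H') * rowProj H) x +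
      act (pinv H') ((b' - b) - act (A' - A) x) +
      act (pinv H') (act ((1 - colProj H) * colProj H')ᴴ (b - rangeProj H b)) := by
    rw [← hcc, mul_act (colProj H'), ← hbb, ← mul_act (pinv H') (colProj H'), pinv_mul_colProj,
      mul_act _ _ x, hQx, sub_act, sub_act, act_sub, act_sub, act_sub, act_sub, ← mul_act (pinv H') A', hA', hAx, rangeProj_eq,
      one_act]
    abel
  rw [key]
  refine (norm_add₃_le).trans (add_le_add (add_le_add ?_ ?_) ?_)
  · rw [norm_neg]; exact norm_act_le _ _
  · refine (norm_act_le _ _).trans (mul_le_mul_of_nonneg_left ?_ (norm_nonneg _))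
    exact (norm_sub_le _ _).trans (add_le_add le_rfl (norm_act_le _ _))
  · refine (norm_act_le _ _).trans (mul_le_mul_of_nonneg_left ?_ (norm_nonneg _))
    refine (norm_act_le _ _).trans_eq ?_
    rw [Matrix.l2_opNorm_conjTranspose]

end

/-! ### Exact data, well-posedness, and perturbation of consistent systems. -/

section

variable {m n : ℕ} {A A' H H' : Matrix (Fin m) (Fin n) ℂ} {b : EuclideanSpace ℂ (Fin m)} {θ : ℝ}

/-! ### The three assertions on the general numerical solution -/

theorem dim_eq_dim_bot_iff {S : AffineSubspace ℂ (EuclideanSpace ℂ (Fin n))} :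
    dim S = dim (⊥ : AffineSubspace ℂ (EuclideanSpace ℂ (Fin n))) ↔ S = ⊥ := by
  refine ⟨fun h => ?_, fun h => by rw [h]⟩
  by_contra hS
  rw [dim, dim, if_neg hS, if_pos rfl] at h
  omega

/-- All nonzero singular values exceed `θ`, so `A` is its own `θ`-projection, and the backward error
is the distance from `b` to the range. -/
theorem isTheNumSol_sol (hθ : 0 < θ) (h1 : θ * ‖pinv A‖ < 1)
    (h2 : b ∉ matRange A → θ < ‖b - rangeProj A b‖) : IsTheNumSol θ A b (sol A b) := by
  obtain ⟨H, hH, hn, -⟩ := (reduces_self A).exists_isThetaProj (A' := A) (θ := θ)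
    (by simpa using hθ) (by simpa using h1)
  obtain rfl : A = H := by
    rw [sub_self, norm_zero, add_zero, norm_le_zero_iff, sub_eq_zero] at hn
    exact hn
  refine IsNumSol.isTheNumSol ⟨A, hH, ?_⟩
  have hbe : backwardError A b A = ‖b - rangeProj A b‖ := by
    rw [backwardError, pairNorm, sub_self, norm_zero]
    simp [Real.sqrt_sq]
  rw [hbe]
  by_cases hb : b ∈ matRange A
  · left
    rw [rangeProj_of_mem hb, sub_self, norm_zero]
    exact ⟨hθ, rfl⟩
  · exact Or.inr ⟨h2 hb, sol_eq_bot_iff.mpr hb⟩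

/-- The projections belonging to the `θ`-projection depend on the matrix in a Lipschitz way. -/
theorem IsThetaProj.exists_lipschitz (hH : IsThetaProj θ A H) :
    ∃ K : ℝ, 0 < K ∧ ∃ δ : ℝ, 0 < δ ∧ ∀ A', ‖A' - A‖ < δ → ∃ H', IsThetaProj θ A' H' ∧
      ‖(1 - colProj H) * colProj H'‖ ≤ K * ‖A' - A‖ ∧
      ‖(1 - rowProj H') * rowProj H‖ ≤ K * ‖A' - A‖ ∧
      ‖colProj H' - colProj H‖ ≤ K * ‖A' - A‖ ∧
      ‖rowProj H' - rowProj H‖ ≤ K * ‖A' - A‖ := by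
  have h1 := hH.norm_sub_lt
  have h2 := hH.mul_norm_pinv_lt
  have hh := norm_nonneg (pinv H)
  have hlo := norm_nonneg (A - H)
  obtain ⟨δ, hδ, hδ1, hδ2⟩ : ∃ δ : ℝ, 0 < δ ∧ ‖A - H‖ + δ < θ ∧ (θ + δ) * ‖pinv H‖ < 1 := by
    have c1 : Filter.Tendsto (fun δ : ℝ => ‖A - H‖ + δ) (nhdsWithin 0 (Set.Ioi 0))
        (nhds (‖A - H‖ + 0)) :=
      ((continuous_const.add continuous_id).tendsto 0).mono_left nhdsWithin_le_nhds
    have c2 : Filter.Tendsto (fun δ : ℝ => (θ + δ) * ‖pinv H‖) (nhdsWithin 0 (Set.Ioi 0))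
        (nhds ((θ + 0) * ‖pinv H‖)) :=
      (((continuous_const.add continuous_id).mul continuous_const).tendsto 0).mono_left
        nhdsWithin_le_nhds
    have c0 : ∀ᶠ δ : ℝ in nhdsWithin 0 (Set.Ioi 0), 0 < δ := self_mem_nhdsWithin
    exact (c0.and ((c1.eventually_lt_const (by simpa using h1)).and
      (c2.eventually_lt_const (by simpa using h2)))).exists
  have hgap : 0 < θ - ‖A - H‖ - δ := by linarith
  -- With pseudoinverse norm at most `1 / θ` and discarded part at most `lo`, the gap inequality has
  -- fixed point `‖A' - A‖ / (θ - lo)`; the worst `lo` is `‖A - H‖ + δ`.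
  refine ⟨1 / (θ - ‖A - H‖ - δ), by positivity, δ, hδ, fun A' hA' => ?_⟩
  set K := 1 / (θ - ‖A - H‖ - δ) with hK
  have hK0 : 0 < K := by positivity
  have hKeq : K * (θ - ‖A - H‖ - δ) = 1 := by rw [hK]; field_simp
  have he := norm_nonneg (A' - A)
  obtain ⟨H', hH', hlo', -⟩ := hH.reduces.exists_isThetaProj (A' := A') (θ := θ) (by linarith)
    (lt_of_le_of_lt (mul_le_mul_of_nonneg_right (by linarith) hh) hδ2)
  have h1' := hH'.norm_sub_lt
  have h2' := hH'.mul_norm_pinv_lt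
  have hh' := norm_nonneg (pinv H')
  have hθ := hH.1
  -- Stated for general `p` and `lo` because the gaps are needed in both directions, with `H` and
  -- `H'` exchanged.
  have contract : ∀ p lo : ℝ, 0 ≤ p → θ * p < 1 → 0 ≤ lo → lo ≤ ‖A - H‖ + δ →
      p * lo < 1 ∧ p * (lo * (K * ‖A' - A‖) + ‖A' - A‖) ≤ K * ‖A' - A‖ := by
    intro p lo hp hpθ hlo0 hlo1
    refine ⟨by nlinarith, ?_⟩
    have s1 : lo * (K * ‖A' - A‖) + ‖A' - A‖ ≤ θ * (K * ‖A' - A‖) := by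
      have : lo * K + 1 ≤ θ * K := by nlinarith
      nlinarith
    calc p * (lo * (K * ‖A' - A‖) + ‖A' - A‖) ≤ p * (θ * (K * ‖A' - A‖)) :=
          mul_le_mul_of_nonneg_left s1 hp
      _ = (θ * p) * (K * ‖A' - A‖) := by ring
      _ ≤ K * ‖A' - A‖ := mul_le_of_le_one_left (by positivity) hpθ.le
  obtain ⟨k1, k2⟩ := contract _ _ hh' h2' hlo (by linarith)
  obtain ⟨k3, k4⟩ := contract _ _ hh h2 (norm_nonneg (A' - H')) (by linarith)
  obtain ⟨g1, g2⟩ := hH.reduces.gaps_le hH'.reduces k1 k2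
  obtain ⟨g3, g4⟩ := hH'.reduces.gaps_le hH.reduces k3 (by rwa [norm_sub_rev A A'])
  exact ⟨H', hH', g1, g4, norm_sub_le_of_isStarProjection (isStarProjection_colProj _)
    (isStarProjection_colProj _) g3 g1, norm_sub_le_of_isStarProjection
    (isStarProjection_rowProj _) (isStarProjection_rowProj _) g4 g2⟩

/-- The backward error is the norm of the pair `(A, b)` after applying `1 - colProj H` to both
entries, so it inherits continuity from the data and the projection. -/
theorem Reduces.abs_backwardError_sub_le (h : Reduces A H) (h' : Reduces A' H')
    (b b' : EuclideanSpace ℂ (Fin m)) :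
    |backwardError A' b' H' - backwardError A b H| ≤
      ‖A' - A‖ + ‖b' - b‖ + ‖colProj H' - colProj H‖ * (‖A‖ + ‖b‖) := by
  refine (abs_pairNorm_sub_le _ _ _ _).trans ?_
  have hP : ‖1 - colProj H'‖ ≤ 1 :=
    norm_le_one_of_isStarProjection (isStarProjection_colProj H').one_sub
  have e1 : A' - H' - (A - H) = (1 - colProj H') * (A' - A) - (colProj H' - colProj H) * A := by
    rw [Matrix.mul_sub, h'.sub_mul, Matrix.sub_mul, Matrix.sub_mul, h.left, Matrix.one_mul]
    abel
  have e2 : b' - rangeProj H' b' - (b - rangeProj H b) =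
      act (1 - colProj H') (b' - b) - act (colProj H' - colProj H) b := by
    simp only [rangeProj_eq, act_sub, sub_act, one_act]
    abel
  have n1 : ‖A' - H' - (A - H)‖ ≤ ‖A' - A‖ + ‖colProj H' - colProj H‖ * ‖A‖ := by
    rw [e1]
    exact (norm_sub_le _ _).trans (add_le_add (norm_mul_le_of_norm_le_one_left hP _)
      (Matrix.l2_opNorm_mul _ _))
  have n2 : ‖b' - rangeProj H' b' - (b - rangeProj H b)‖ ≤
      ‖b' - b‖ + ‖colProj H' - colProj H‖ * ‖b‖ := by
    rw [e2]
    exact (norm_sub_le _ _).trans (add_le_add ((norm_act_le _ _).trans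
      (mul_le_of_le_one_left (norm_nonneg _) hP)) (norm_act_le _ _))
  linarith

theorem IsNumSol.wellPosed {S : AffineSubspace ℂ (EuclideanSpace ℂ (Fin n))}
    (hS : IsNumSol θ A b S) :
    ∃ ξ : ℝ, 0 < ξ ∧ ∃ δ : ℝ, 0 < δ ∧
      ∀ (dA : Matrix (Fin m) (Fin n) ℂ) (db : EuclideanSpace ℂ (Fin m)), pairNorm dA db < δ →
        ∃ T, IsTheNumSol θ (A + dA) (b + db) T ∧ dim T = dim S ∧
          affDist T S ≤ ξ * pairNorm dA db := by
  obtain ⟨H, hH, hS⟩ := hS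
  obtain ⟨K, hK, δ₀, hδ₀, hL⟩ := hH.exists_lipschitz
  have hθ := hH.1
  set x := act (pinv H) b with hx
  set r := ‖b - rangeProj H b‖ with hr
  set C := 2 + K * (‖A‖ + ‖b‖) with hC
  have hC0 : 0 < C := by positivity
  -- The first three terms match those of `Reduces.norm_pinv_sub_le`, with `1 / θ` bounding `‖pinv
  -- H'‖`; the last controls the directions.
  set ξ := K * ‖x‖ + 1 / θ * (1 + ‖x‖) + 1 / θ * (K * r) + K with hξ
  have hξ0 : 0 < ξ := by positivity
  set gap := |backwardError A b H - θ| with hgap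
  have hgap0 : 0 < gap := by
    refine abs_pos.mpr (sub_ne_zero.mpr ?_)
    rcases hS with ⟨h, -⟩ | ⟨h, -⟩
    exacts [h.ne, h.ne']
  -- `δ₀` gives the Lipschitz bounds, `gap / C` keeps the backward error on its side of `θ`, and `1
  -- / K` keeps the row projections at distance below 1, so the dimension is preserved.
  refine ⟨ξ, hξ0, min δ₀ (min (gap / C) (1 / K)), by positivity, fun dA db hlt => ?_⟩
  obtain ⟨l1, l2, l3⟩ : pairNorm dA db < δ₀ ∧ pairNorm dA db < gap / C ∧
      pairNorm dA db < 1 / K := by simpa [lt_min_iff] using hlt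
  rw [lt_div_iff₀ hC0] at l2
  rw [lt_div_iff₀ hK] at l3
  have hA := norm_le_pairNorm dA db
  have hb := norm_le_pairNorm' dA db
  have hε := pairNorm_nonneg dA db
  set ε := pairNorm dA db
  obtain ⟨H', hH', g1, g2, g3, g4⟩ := hL (A + dA) (by rw [add_sub_cancel_left]; linarith)
  have hbe := hH.reduces.abs_backwardError_sub_le hH'.reduces b (b + db)
  have hmn := hH.reduces.norm_pinv_sub_le hH'.reduces b (b + db)
  rw [add_sub_cancel_left] at g1 g2 g3 g4
  rw [add_sub_cancel_left, add_sub_cancel_left] at hbe hmn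
  have hKA : K * ‖dA‖ ≤ K * ε := mul_le_mul_of_nonneg_left hA hK.le
  have hbe' : |backwardError (A + dA) (b + db) H' - backwardError A b H| < gap := by
    refine hbe.trans_lt (lt_of_le_of_lt ?_ l2)
    have := mul_le_mul_of_nonneg_right (g3.trans hKA) (by positivity : 0 ≤ ‖A‖ + ‖b‖)
    rw [hC]
    linarith
  rw [abs_lt] at hbe'
  rcases hS with ⟨h, rfl⟩ | ⟨h, rfl⟩
  · rw [hgap, abs_of_neg (by linarith)] at hbe'
    refine ⟨sol H' (rangeProj H' (b + db)), IsNumSol.isTheNumSol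
      ⟨H', hH', Or.inl ⟨by linarith, rfl⟩⟩, dim_sol_eq _ _ (by linarith), ?_⟩
    rw [affDist_sol]
    refine max_le (hmn.trans ?_) (g4.trans (hKA.trans ?_))
    · have hh' : ‖pinv H'‖ ≤ 1 / θ := by
        rw [le_div_iff₀ hθ, mul_comm]; exact hH'.mul_norm_pinv_lt.le
      have t1 : ‖(1 - rowProj H') * rowProj H‖ * ‖x‖ ≤ K * ε * ‖x‖ :=
        mul_le_mul_of_nonneg_right (g2.trans hKA) (norm_nonneg _)
      have t2 : ‖pinv H'‖ * (‖db‖ + ‖dA‖ * ‖x‖) ≤ 1 / θ * (ε + ε * ‖x‖) :=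
        mul_le_mul hh' (add_le_add hb (mul_le_mul_of_nonneg_right hA (norm_nonneg _)))
          (by positivity) (by positivity)
      have t3 : ‖pinv H'‖ * (‖(1 - colProj H) * colProj H'‖ * r) ≤ 1 / θ * (K * ε * r) :=
        mul_le_mul hh' (mul_le_mul_of_nonneg_right (g1.trans hKA) (norm_nonneg _))
          (by positivity) (by positivity)
      have : 0 ≤ K * ε := by positivity
      calc _ ≤ K * ε * ‖x‖ + 1 / θ * (ε + ε * ‖x‖) + 1 / θ * (K * ε * r) :=
            add_le_add (add_le_add t1 t2) t3
        _ = ξ * ε - K * ε := by rw [hξ]; ring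
        _ ≤ ξ * ε := by linarith
    · refine mul_le_mul_of_nonneg_right ?_ hε
      rw [hξ]
      exact le_add_of_nonneg_left (by positivity)
  · rw [hgap, abs_of_pos (by linarith)] at hbe'
    refine ⟨⊥, IsNumSol.isTheNumSol ⟨H', hH', Or.inr ⟨by linarith, rfl⟩⟩, rfl, ?_⟩
    rw [affDist_bot]
    positivity

/-- Comparison with `H = A` leaves no discarded part in the reference matrix and no residual in `b`,
so the general estimates become explicit in `‖A†‖` and `‖dA‖`. -/
theorem consistent_perturbation (hb : b ∈ matRange A) {dA : Matrix (Fin m) (Fin n) ℂ}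
    {db : EuclideanSpace ℂ (Fin m)}
    (h1 : pairNorm dA db * ((Real.sqrt (4 * ‖pinv A‖ ^ 2 * ‖b‖ ^ 2 + 2) + 1) * ‖pinv A‖) < 1)
    (h2 : Real.sqrt (4 * ‖pinv A‖ ^ 2 * ‖b‖ ^ 2 + 2) * pairNorm dA db < θ)
    (h3 : (θ + pairNorm dA db) * ‖pinv A‖ < 1) :
    ∃ T, IsTheNumSol θ (A + dA) (b + db) T ∧
      (∃ H, IsThetaProj θ (A + dA) H ∧ T = sol H (rangeProj H (b + db)) ∧
        backwardError (A + dA) (b + db) H ≤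
          Real.sqrt (4 * ‖pinv A‖ ^ 2 * ‖b‖ ^ 2 + 2) * pairNorm dA db) ∧
      dim T = dim (sol A b) ∧
      affDist T (sol A b) ≤
        ‖A‖ * ‖pinv A‖ * (Real.sqrt (4 * ‖act (pinv A) b‖ ^ 2 + 1) /
          (‖A‖ - ‖A‖ * ‖pinv A‖ * ‖dA‖)) * pairNorm dA db := by
  have hA := norm_le_pairNorm dA db
  have hdb := norm_le_pairNorm' dA db
  have hε := pairNorm_nonneg dA db
  have hh := norm_nonneg (pinv A)
  have he := norm_nonneg dA
  have hω : 1 ≤ Real.sqrt (4 * ‖pinv A‖ ^ 2 * ‖b‖ ^ 2 + 2) :=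
    Real.one_le_sqrt.mpr (by nlinarith [sq_nonneg (‖pinv A‖ * ‖b‖)])
  set ω := Real.sqrt (4 * ‖pinv A‖ ^ 2 * ‖b‖ ^ 2 + 2) with hωdef
  set x := act (pinv A) b with hx
  have hx0 := norm_nonneg x
  have hs := add_le_sqrt_mul_pairNorm dA db ‖x‖
  have hs1 : 1 ≤ Real.sqrt (4 * ‖x‖ ^ 2 + 1) := Real.one_le_sqrt.mpr (by nlinarith)
  set ε := pairNorm dA db with hεdef
  set h := ‖pinv A‖ with hhdef
  set e := ‖dA‖ with hedef
  -- Since `ω ≥ 1`, the bound `h1` gives this factor 2, which later makes `η * e < 1` and so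
  -- preserves the dimension.
  have hhe : 2 * (h * e) < 1 := by
    have : 2 * (h * e) ≤ ε * ((ω + 1) * h) := by
      have a1 : h * e ≤ h * ε := mul_le_mul_of_nonneg_left hA hh
      have a2 : 0 ≤ (ω - 1) * (h * ε) := mul_nonneg (by linarith) (by positivity)
      linarith
    linarith
  have hpos : 0 < 1 - h * e := by nlinarith [mul_nonneg hh he]
  have eE : A + dA - A = dA := add_sub_cancel_left _ _
  obtain ⟨H', hH', hlo', hp'⟩ := (reduces_self A).exists_isThetaProj (A' := A + dA) (θ := θ)
    (by rw [eE, sub_self, norm_zero, zero_add]; nlinarith)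
    (by rw [eE]; exact lt_of_le_of_lt (mul_le_mul_of_nonneg_right (by linarith) hh) h3)
  rw [eE, sub_self, norm_zero, zero_add] at hlo'
  rw [eE, ← le_div_iff₀ hpos] at hp'
  have hred := hH'.reduces
  set η := h / (1 - h * e) with hη
  have hη0 : 0 ≤ η := by positivity
  -- So `η * e` is the fixed point of the reverse gap inequality, whose contraction factor is at
  -- most `h * e`.
  have hη1 : h * (e * (η * e) + e) = η * e := by rw [hη]; field_simp; ring
  obtain ⟨g1, g2⟩ := (reduces_self A).gaps_le hred (c := η * e)
    (by rw [sub_self, norm_zero, mul_zero]; exact one_pos)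
    (by rw [sub_self, norm_zero, zero_mul, zero_add, eE]; exact mul_le_mul_of_nonneg_right hp' he)
  obtain ⟨g3, g4⟩ := hred.gaps_le (reduces_self A) (c := η * e)
    (by have := mul_le_mul_of_nonneg_left hlo' hh; linarith)
    (by
      rw [norm_sub_rev A, eE]
      refine le_trans ?_ hη1.le
      exact mul_le_mul_of_nonneg_left
        (add_le_add (mul_le_mul_of_nonneg_right hlo' (by positivity)) le_rfl) hh)
  have g5 : ‖rowProj H' - rowProj A‖ ≤ η * e := norm_sub_le_of_isStarProjection
    (isStarProjection_rowProj _) (isStarProjection_rowProj _) g4 g2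
  have hηe : η * e < 1 := by
    rw [hη, div_mul_eq_mul_div, div_lt_one hpos]; linarith
  have hbA : rangeProj A b = b := rangeProj_of_mem hb
  have hsolA : sol A b = sol A (rangeProj A b) := by rw [hbA]
  have hAx : act A x = b := hbA
  have hbe : backwardError (A + dA) (b + db) H' ≤ ω * ε := by
    have hP : ‖1 - colProj H'‖ ≤ 1 :=
      norm_le_one_of_isStarProjection (isStarProjection_colProj H').one_sub
    -- Substitute `b + db = (A + dA) x + (db - dA x)`; both `A + dA - H'` and `dA` have norm at most
    -- `e`, whence `2 * ‖x‖ * e`.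
    have e1 : b + db - rangeProj H' (b + db) = act (A + dA - H') x +
        act (1 - colProj H') (db - act dA x) := by
      rw [← hred.sub_mul, mul_act, ← act_add, add_act, hAx, rangeProj_eq, sub_act, one_act]
      congr 1
      · abel
      · congr 1; abel
    have n1 : ‖b + db - rangeProj H' (b + db)‖ ≤ 2 * ‖x‖ * e + ‖db‖ := by
      rw [e1]
      refine (norm_add_le _ _).trans ?_
      have a1 := (norm_act_le (A + dA - H') x).trans (mul_le_mul_of_nonneg_right hlo' hx0)
      have a2 := (norm_act_le (1 - colProj H') (db - act dA x)).trans
        (mul_le_of_le_one_left (norm_nonneg _) hP)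
      have a3 := (norm_sub_le db (act dA x)).trans (add_le_add le_rfl (norm_act_le dA x))
      linarith
    have hxb : ‖x‖ ≤ h * ‖b‖ := norm_act_le _ _
    have n2 := pow_le_pow_left₀ (norm_nonneg _) (n1.trans hs) 2
    rw [mul_pow, Real.sq_sqrt (by positivity)] at n2
    rw [backwardError, pairNorm]
    refine Real.sqrt_le_iff.mpr ⟨by positivity, ?_⟩
    -- In `ω² = 4h²‖b‖² + 2`, Cauchy-Schwarz on the vector part gives `4‖x‖² + 1` with `‖x‖ ≤ h *
    -- ‖b‖`, and the matrix part adds another 1.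
    rw [mul_pow, hωdef, Real.sq_sqrt (by positivity)]
    have n3 := pow_le_pow_left₀ (norm_nonneg _) (hlo'.trans hA) 2
    have n4 := pow_le_pow_left₀ hx0 hxb 2
    have n5 := mul_le_mul_of_nonneg_right n4 (sq_nonneg ε)
    rw [mul_pow] at n5
    linarith
  refine ⟨sol H' (rangeProj H' (b + db)), IsNumSol.isTheNumSol
    ⟨H', hH', Or.inl ⟨hbe.trans_lt h2, rfl⟩⟩, ⟨H', hH', rfl, hbe⟩, ?_, ?_⟩
  · rw [hsolA]
    exact dim_sol_eq _ _ (g5.trans_lt hηe)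
  · have hbound : affDist (sol H' (rangeProj H' (b + db))) (sol A b) ≤
        η * (Real.sqrt (4 * ‖x‖ ^ 2 + 1) * ε) := by
      rw [hsolA]
      rw [affDist_sol]
      refine max_le ?_ (g5.trans (mul_le_mul_of_nonneg_left ?_ hη0))
      · have hmn := (reduces_self A).norm_pinv_sub_le hred b (b + db)
        rw [eE, add_sub_cancel_left, hbA, sub_self, norm_zero, mul_zero, mul_zero, add_zero] at hmn
        refine hmn.trans ((add_le_add (mul_le_mul_of_nonneg_right g4 hx0)
          (mul_le_mul_of_nonneg_right hp' (by positivity))).trans ?_)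
        refine le_trans (le_of_eq ?_) (mul_le_mul_of_nonneg_left hs hη0)
        ring
      · exact hA.trans (le_mul_of_one_le_left hε hs1)
    refine hbound.trans_eq ?_
    -- For `A = 0` both sides vanish because `‖A†‖ = 0`, whatever value the quotient takes.
    rcases eq_or_ne A 0 with hA0 | hA0
    · have hp0 : pinv A = 0 := by
        have := rowProj_mul_pinv A
        rw [rowProj, hA0] at this
        rw [hA0]
        simpa using this.symm
      have hh0 : h = 0 := by rw [hhdef, hp0, norm_zero]
      rw [hη, hh0]
      simp
    · have hAn : ‖A‖ ≠ 0 := norm_ne_zero_iff.mpr hA0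
      have e1 : ‖A‖ - ‖A‖ * h * e = ‖A‖ * (1 - h * e) := by ring
      rw [e1, hη]
      have := hpos.ne'
      field_simp

end

end SingularSystem

open SingularSystem
theorem theorem3 {m n : ℕ} (A : Matrix (Fin m) (Fin n) ℂ) (b : EuclideanSpace ℂ (Fin m)) :
    -- (i) the exact solution is a special case; `θ * ‖A†‖ < 1` says `θ < ‖A†‖⁻¹` (`= ∞` for `A = 0`)
    (∀ θ : ℝ, 0 < θ → θ * ‖pinv A‖ < 1 →
      (b ∉ matRange A → θ < ‖b - rangeProj A b‖) →
      IsTheNumSol θ A b (sol A b)) ∧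
    -- (ii) well-posedness
    (∀ θ : ℝ, 0 < θ → ∀ S, IsNumSol θ A b S →
      ∃ ξ : ℝ, 0 < ξ ∧ ∃ δ : ℝ, 0 < δ ∧
        ∀ (dA : Matrix (Fin m) (Fin n) ℂ) (db : EuclideanSpace ℂ (Fin m)), pairNorm dA db < δ →
          ∃ T, IsTheNumSol θ (A + dA) (b + db) T ∧ dim T = dim S ∧
            affDist T S ≤ ξ * pairNorm dA db) ∧
    -- (iii)(a) consistent systems from empirical data
    (b ∈ matRange A →
      ∀ ω : ℝ, ω = Real.sqrt (4 * ‖pinv A‖ ^ 2 * ‖b‖ ^ 2 + 2) →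
      ∀ (dA : Matrix (Fin m) (Fin n) ℂ) (db : EuclideanSpace ℂ (Fin m)),
        pairNorm dA db * ((ω + 1) * ‖pinv A‖) < 1 →
        ∀ θ : ℝ, ω * pairNorm dA db < θ → (θ + pairNorm dA db) * ‖pinv A‖ < 1 →
          ∃ T, IsTheNumSol θ (A + dA) (b + db) T ∧
            (∃ H, IsThetaProj θ (A + dA) H ∧ T = sol H (rangeProj H (b + db)) ∧
              backwardError (A + dA) (b + db) H ≤ ω * pairNorm dA db) ∧
            dim T = dim (sol A b) ∧
            affDist T (sol A b) ≤
              ‖A‖ * ‖pinv A‖ *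
                (Real.sqrt (4 * ‖act (pinv A) b‖ ^ 2 + 1) /
                  (‖A‖ - ‖A‖ * ‖pinv A‖ * ‖dA‖)) * pairNorm dA db) ∧
    -- (iii)(b) inconsistent systems
    (sol A b = ⊥ →
      ∀ θ : ℝ, 0 < θ → θ * (2 * ‖pinv A‖) < 1 → θ < ‖b - rangeProj A b‖ →
        ∃ ρ : ℝ, 0 < ρ ∧ ρ < θ ∧
          ∀ (A' : Matrix (Fin m) (Fin n) ℂ) (b' : EuclideanSpace ℂ (Fin m)),
            pairNorm (A' - A) (b' - b) < ρ → IsTheNumSol θ A' b' ⊥) := by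
  have well_posed : ∀ θ : ℝ, ∀ S, IsNumSol θ A b S →
      ∃ ξ : ℝ, 0 < ξ ∧ ∃ δ : ℝ, 0 < δ ∧
        ∀ (dA : Matrix (Fin m) (Fin n) ℂ) (db : EuclideanSpace ℂ (Fin m)), pairNorm dA db < δ →
          ∃ T, IsTheNumSol θ (A + dA) (b + db) T ∧ dim T = dim S ∧
            affDist T S ≤ ξ * pairNorm dA db := fun θ S hS => hS.wellPosed
  have exact_sol : ∀ θ : ℝ, 0 < θ → θ * ‖pinv A‖ < 1 →
      (b ∉ matRange A → θ < ‖b - rangeProj A b‖) → IsTheNumSol θ A b (sol A b) :=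
    fun θ hθ h1 h2 => isTheNumSol_sol hθ h1 h2
  refine ⟨exact_sol, fun θ _ => well_posed θ, ?_, ?_⟩
  · rintro hb ω rfl dA db h1 θ h2 h3
    exact consistent_perturbation hb h1 h2 h3
  · intro hsol θ hθ h1 h2
    have hnum := exact_sol θ hθ (by nlinarith [norm_nonneg (pinv A)]) fun _ => h2
    obtain ⟨ξ, -, δ, hδ, H⟩ := well_posed θ _ hnum.1
    -- The cap `θ / 2` serves only to make `ρ < θ`.
    refine ⟨min δ (θ / 2), by positivity, (min_le_right _ _).trans_lt (by linarith), ?_⟩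
    intro A' b' hlt
    obtain ⟨T, hT, hdim, -⟩ := H _ _ (hlt.trans_le (min_le_left _ _))
    rw [add_sub_cancel, add_sub_cancel] at hT
    -- Dimension `-1` forces the perturbed solution to be empty.
    rw [hsol, dim_eq_dim_bot_iff] at hdim
    rwa [hdim] at hT
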